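/- Let $V$ be a finite nonempty set of $n=|V|\ge 1$ vertices and let $p\in(0,1)$. Let $G$ be the random multidigraph on $V$ with geometric outdegrees: independently for each vertex $v$, the outdegree $d^+(v)$ satisfies $\mathbb P(d^+(v)=k)=(1-p)p^k$ for $k=0,1,2,\dots$ (mean $\frac p{1-p}$), and from $v$ there are $d^+(v)$ arcs $v\to u$ whose endpoints $u$ are independent uniform random vertices (loops and parallel arcs are allowed). Run depth-first search (DFS) on $G$: choose an unvisited vertex $v$ as a root and explore the arcs from $v$ one after another, in the order in which they were generated; whenever an arc points to an unvisited vertex $u$, recursively perform DFS from $u$ before going on; repeat with a new unvisited root until all vertices have been visited. The roots may be chosen by any fixed deterministic rule that depends only on what has been visited and explored so far. An arc that points to an unvisited vertex when it is explored is a tree arc; the tree arcs form the depth-first forest. An arc $v\to u$ that is not a tree arc is a loop if $u=v$, a forward arc if $u$ is a proper descendant of $v$ in the depth-first forest, a back arc if $u$ is a proper ancestor of $v$ in the depth-first forest, and a cross arc otherwise. Let $L,F,B,C,T$ be the numbers of loops, forward, back, cross and tree arcs. Then $F$ and $B$ have the same distribution. More strongly, the random vectors $(L,F,B+C,T)$ and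 $(L,B,F+C,T)$ have the same joint distribution. -/

import Mathlib

open MeasureTheory ProbabilityTheory

/-- A multidigraph on the vertex set `V`: `G v` lists the heads `u` of the arcs `v → u` leaving `v`,
in the order in which a depth-first search explores them. Loops and parallel arcs are allowed. -/
abbrev Multidigraph (V : Type*) : Type _ := V → List V

/-- An arc explored by a depth-first search, together with the information whether its head was
still unvisited when the arc was explored, that is, whether it is a tree arc. -/
structure ExploredArc (V : Type*) where
  tail : V
  head : V
  isTree : Bool

/-- The state of a depth-first search: the vertices visited so far, and the arcs explored so far
(the most recent one first; an arc occurs as often as it was explored). -/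
structure DFSState (V : Type*) where
  visited : Finset V
  explored : List (ExploredArc V)

namespace Multidigraph

/-- `G.exploreArcs v s arcs` explores, from the state `s`, the arcs from `v` to the vertices in the
list `arcs`, one after the other. Whenever an arc points to an unvisited vertex `u`, it is a tree
arc, `u` becomes visited, and all arcs leaving `u` are explored recursively before the search goes
on with the next arc from `v`. The subtype records that visited vertices stay visited; it serves
only to show termination. -/
def exploreArcs {V : Type*} [Fintype V] [DecidableEq V] (G : Multidigraph V) (v : V)
    (s : DFSState V) (arcs : List V) :
    {t : DFSState V // s.visited ⊆ t.visited} :=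
  match arcs with
  | [] => ⟨s, Finset.Subset.refl _⟩
  | u :: rest =>
    if h : u ∈ s.visited then
      let t := exploreArcs G v ⟨s.visited, ⟨v, u, false⟩ :: s.explored⟩ rest
      ⟨t.1, t.2⟩
    else
      let t := exploreArcs G u ⟨insert u s.visited, ⟨v, u, true⟩ :: s.explored⟩ (G u)
      let t' := exploreArcs G v t.1 rest
      ⟨t'.1, (Finset.subset_insert u s.visited).trans (t.2.trans t'.2)⟩
termination_by (s.visitedᶜ.card, arcs.length)
decreasing_by
  · exact Prod.Lex.right _ (by simp)
  · refine Prod.Lex.left _ _ (Finset.card_lt_card ?_)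
    exact Finset.compl_ssubset_compl.2 (Finset.ssubset_insert h)
  · refine Prod.Lex.left _ _ (Finset.card_lt_card ?_)
    exact Finset.compl_ssubset_compl.2 ((Finset.ssubset_insert h).trans_subset t.2)

/-- Depth-first search from the vertex `v`, started in the state `s`. -/
def visit {V : Type*} [Fintype V] [DecidableEq V] (G : Multidigraph V) (v : V)
    (s : DFSState V) :
    {t : DFSState V // insert v s.visited ⊆ t.visited} :=
  G.exploreArcs v ⟨insert v s.visited, s.explored⟩ (G v)

end Multidigraph

/-- A rule that selects, as long as there are unvisited vertices, the unvisited vertex from which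
the search is started anew. It may depend on everything that has been explored so far, and on
nothing else. -/
abbrev RootRule (V : Type*) [Fintype V] : Type _ :=
  (s : DFSState V) → s.visited ≠ Finset.univ → {v : V // v ∉ s.visited}

namespace Multidigraph

variable {V : Type*} [Fintype V] [DecidableEq V]

/-- Depth-first search from the state `s`: start from unvisited vertices, selected by `root`, until
all vertices have been visited. -/
def dfsFrom (G : Multidigraph V) (root : RootRule V) (s : DFSState V) : DFSState V :=
  if h : s.visited = Finset.univ then s
  else dfsFrom G root (G.visit (root s h).1 s).1
termination_by s.visitedᶜ.card
decreasing_by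
  refine Finset.card_lt_card (Finset.compl_ssubset_compl.2 ?_)
  exact (Finset.ssubset_insert (root s h).2).trans_subset (G.visit (root s h).1 s).2

/-- The outcome of the depth-first search of the whole multidigraph. -/
def dfs (G : Multidigraph V) (root : RootRule V) : DFSState V :=
  G.dfsFrom root ⟨∅, []⟩

end Multidigraph

namespace DFSState

variable {V : Type*}

/-- `u` is the parent of `w` in the depth-first forest, whose arcs are the tree arcs. -/
def IsParent (s : DFSState V) (u w : V) : Prop :=
  (⟨u, w, true⟩ : ExploredArc V) ∈ s.explored

/-- `u` is an ancestor of `w` (and `w` a descendant of `u`) in the depth-first forest: there is a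
directed path of at least one tree arc from `u` to `w`. -/
def IsAncestor (s : DFSState V) (u w : V) : Prop :=
  Relation.TransGen s.IsParent u w

def IsLoop (_s : DFSState V) (a : ExploredArc V) : Prop :=
  a.isTree = false ∧ a.head = a.tail

def IsForward (s : DFSState V) (a : ExploredArc V) : Prop :=
  a.isTree = false ∧ s.IsAncestor a.tail a.head

def IsBack (s : DFSState V) (a : ExploredArc V) : Prop :=
  a.isTree = false ∧ s.IsAncestor a.head a.tail

/-- A cross arc is a non-tree arc that is neither a loop nor a forward arc nor a back arc. -/
def IsCross (s : DFSState V) (a : ExploredArc V) : Prop :=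
  a.isTree = false ∧ ¬ s.IsLoop a ∧ ¬ s.IsForward a ∧ ¬ s.IsBack a

open Classical in
noncomputable def numLoops (s : DFSState V) : ℕ := s.explored.countP (fun a => s.IsLoop a)

open Classical in
noncomputable def numForward (s : DFSState V) : ℕ := s.explored.countP (fun a => s.IsForward a)

open Classical in
noncomputable def numBack (s : DFSState V) : ℕ := s.explored.countP (fun a => s.IsBack a)

open Classical in
noncomputable def numCross (s : DFSState V) : ℕ := s.explored.countP (fun a => s.IsCross a)

def numTree (s : DFSState V) : ℕ := s.explored.countP (fun a => a.isTree)

end DFSState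

/-- Every set of finite lists is measurable. -/
instance List.instMeasurableSpaceTop {V : Type*} : MeasurableSpace (List V) := ⊤

section RandomDigraph

variable (V : Type*) [Fintype V] [Nonempty V]

/-- The distribution of the list of heads of the arcs leaving one vertex: the number `k` of arcs is
geometric on `{0, 1, 2, …}` with `P(k) = (1 - p) p ^ k` (Mathlib's `geometricMeasure` is
parametrized by the success probability, here `1 - p`), and given `k`, the `k` heads are independent
and uniform, that is, uniform on `V ^ k`. -/
noncomputable def outArcsPMF (p : unitInterval) : PMF (List V) :=
  (geometricMeasure (unitInterval.symm p)).toPMF.bind fun k =>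
    (PMF.uniformOfFintype (Fin k → V)).map List.ofFn

/-- The distribution of the random multidigraph on `V` with geometric outdegrees: the lists of arcs
leaving the different vertices are independent. -/
noncomputable def geometricDigraph (p : unitInterval) : Measure (Multidigraph V) :=
  Measure.pi fun _ : V => (outArcsPMF V p).toMeasure

end RandomDigraph

/-! Geometric outdegrees are memoryless: however many arcs of the current vertex `v` have been
explored, its list ends now with probability `1 - p`, and otherwise the next head is uniform. Let
`n` be the number of vertices, `q = p / n`, and let `N` be the number of visited vertices, `d` the
number of ancestors of `v` and `D` the number of its descendants so far. Then the next arc is a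
loop, forward, back or cross arc with probability `q`, `q D`, `q d`, `q (N - 1 - D - d)`; its type
is final once it is explored. Hence the non-tree arcs between two tree moves contribute a geometric
series `stepWeight`, which depends only on `(N, d, D)`.

The search from a root is thus a walk around a plane tree. With `k` further vertices, its generating
function is `treeSum`, the sum over plane trees of the products of step weights along the `2 k + 1`
positions of the walk, times factors for list ends, tree arcs and the choice of their heads. These
factors do not involve the forward, back and cross weights (`expectedWeight_eq_searchExpect`).

For `(L, F, B + C, T)` back and cross arcs share a weight, and a step weight is `1 / (a - γ N - β
D)`; for `(L, B, F + C, T)` it is `1 / (a - γ N - β d)` with the same constants. So it remains to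
see that depth and number of descendants give the same `treeSum` from a root
(`treeSum_depth_eq_desc`). Removing the last child of the root yields a quadratic recursion for each
sum. The recursions differ, but the depth solution also satisfies the descendant one
(`DepthRecursion.succ_desc`), thanks to the difference identity `DepthRecursion.sub_eq_sum`.

Composing over successive roots (`integral_weight_dfs_congr`) and taking weights on the unit torus
identifies the joint laws. -/

/-! ### The depth-first forest as the search proceeds -/

namespace DFSState

variable {V : Type*}

/-- The endpoints of all explored arcs are visited, and the depth-first forest is acyclic. -/
structure Consistent (s : DFSState V) : Prop where
  tail_mem : ∀ a ∈ s.explored, a.tail ∈ s.visited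
  head_mem : ∀ a ∈ s.explored, a.head ∈ s.visited
  acyclic : ∀ a, ¬ s.IsAncestor a a

lemma consistent_init : (⟨∅, []⟩ : DFSState V).Consistent where
  tail_mem := by simp
  head_mem := by simp
  acyclic a h := by
    obtain ⟨b, hb, _⟩ := Relation.TransGen.head'_iff.1 h
    simp [IsParent] at hb

lemma Consistent.tail_mem_of_isAncestor {s : DFSState V} (hs : s.Consistent) {a w : V}
    (h : s.IsAncestor a w) : a ∈ s.visited := by
  obtain ⟨b, hb, _⟩ := Relation.TransGen.head'_iff.1 h
  exact hs.tail_mem _ hb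

lemma Consistent.head_mem_of_isAncestor {s : DFSState V} (hs : s.Consistent) {a w : V}
    (h : s.IsAncestor a w) : w ∈ s.visited := by
  obtain ⟨b, _, hb⟩ := Relation.TransGen.tail'_iff.1 h
  exact hs.head_mem _ hb

lemma Consistent.not_isAncestor_symm {s : DFSState V} (hs : s.Consistent) {a w : V}
    (h : s.IsAncestor a w) : ¬ s.IsAncestor w a :=
  fun h' => hs.acyclic a (h.trans h')

/-- The state after a non-tree arc `v → u` has been explored. -/
abbrev addNonTree (s : DFSState V) (v u : V) : DFSState V :=
  ⟨s.visited, ⟨v, u, false⟩ :: s.explored⟩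

/-- The state after a tree arc `v → u` has been explored. -/
abbrev addTree [DecidableEq V] (s : DFSState V) (v u : V) : DFSState V :=
  ⟨insert u s.visited, ⟨v, u, true⟩ :: s.explored⟩

/-- The state after a new root `v` has been selected. -/
abbrev addRoot [DecidableEq V] (s : DFSState V) (v : V) : DFSState V :=
  ⟨insert v s.visited, s.explored⟩

lemma isAncestor_addNonTree (s : DFSState V) (v u : V) :
    (s.addNonTree v u).IsAncestor = s.IsAncestor := by
  have : (s.addNonTree v u).IsParent = s.IsParent := by
    ext a b; simp [IsParent]
  unfold IsAncestor
  rw [this]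

/-- The new vertex `u` has no outgoing tree arc, so it is a leaf: a path can use `v → u` only as its
last arc. -/
lemma Consistent.isAncestor_addTree [DecidableEq V] {s : DFSState V} (hs : s.Consistent) {v u : V}
    (hv : v ∈ s.visited) (hu : u ∉ s.visited) (a w : V) :
    (s.addTree v u).IsAncestor a w ↔
      s.IsAncestor a w ∨ (w = u ∧ (a = v ∨ s.IsAncestor a v)) := by
  have hpar : ∀ a w, (s.addTree v u).IsParent a w ↔ (a = v ∧ w = u) ∨ s.IsParent a w := by
    intro a w; simp [IsParent]
  constructor
  · intro h
    induction h with
    | single h =>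
      rcases (hpar _ _).1 h with ⟨rfl, rfl⟩ | h
      · exact Or.inr ⟨rfl, Or.inl rfl⟩
      · exact Or.inl (.single h)
    | tail _ h ih =>
      rcases (hpar _ _).1 h with ⟨rfl, rfl⟩ | h'
      · rcases ih with ih | ⟨rfl, _⟩
        · exact Or.inr ⟨rfl, Or.inr ih⟩
        · exact absurd hv hu
      · rcases ih with ih | ⟨rfl, _⟩
        · exact Or.inl (ih.tail h')
        · exact absurd (hs.tail_mem _ h') hu
  · have hmono : ∀ {a w}, s.IsAncestor a w → (s.addTree v u).IsAncestor a w :=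
      fun h => Relation.TransGen.mono (fun a w h => (hpar a w).2 (Or.inr h)) _ _ h
    rintro (h | ⟨rfl, rfl | h⟩)
    · exact hmono h
    · exact .single ((hpar _ _).2 (Or.inl ⟨rfl, rfl⟩))
    · exact (hmono h).tail ((hpar _ _).2 (Or.inl ⟨rfl, rfl⟩))

lemma Consistent.isAncestor_addTree_of_mem [DecidableEq V] {s : DFSState V} (hs : s.Consistent)
    {v u : V} (hv : v ∈ s.visited) (hu : u ∉ s.visited) (a : V) {w : V} (hw : w ∈ s.visited) :
    (s.addTree v u).IsAncestor a w ↔ s.IsAncestor a w := by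
  rw [hs.isAncestor_addTree hv hu]
  simp [ne_of_mem_of_not_mem hw hu]

lemma Consistent.addNonTree {s : DFSState V} (hs : s.Consistent) {v u : V}
    (hv : v ∈ s.visited) (hu : u ∈ s.visited) : (s.addNonTree v u).Consistent where
  tail_mem a ha := by
    rcases List.mem_cons.1 ha with rfl | ha
    exacts [hv, hs.tail_mem a ha]
  head_mem a ha := by
    rcases List.mem_cons.1 ha with rfl | ha
    exacts [hu, hs.head_mem a ha]
  acyclic a := by rw [isAncestor_addNonTree]; exact hs.acyclic a

lemma Consistent.addTree [DecidableEq V] {s : DFSState V} (hs : s.Consistent) {v u : V}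
    (hv : v ∈ s.visited) (hu : u ∉ s.visited) : (s.addTree v u).Consistent where
  tail_mem a ha := by
    rcases List.mem_cons.1 ha with rfl | ha
    exacts [Finset.mem_insert_of_mem hv, Finset.mem_insert_of_mem (hs.tail_mem a ha)]
  head_mem a ha := by
    rcases List.mem_cons.1 ha with rfl | ha
    exacts [Finset.mem_insert_self _ _, Finset.mem_insert_of_mem (hs.head_mem a ha)]
  acyclic a := by
    rw [hs.isAncestor_addTree hv hu]
    rintro (h | ⟨rfl, rfl | h⟩)
    · exact hs.acyclic a h
    · exact hu hv
    · exact hu (hs.tail_mem_of_isAncestor h)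

lemma Consistent.addRoot [DecidableEq V] {s : DFSState V} (hs : s.Consistent) (v : V) :
    (s.addRoot v).Consistent where
  tail_mem a ha := Finset.mem_insert_of_mem (hs.tail_mem a ha)
  head_mem a ha := Finset.mem_insert_of_mem (hs.head_mem a ha)
  acyclic := hs.acyclic

/-- `t` arises from `s` by exploring arcs in such a way that the forest is only extended by proper
descendants of `v`. -/
structure ExtendsBelow (v : V) (s t : DFSState V) : Prop where
  consistent : t.Consistent
  subset : s.visited ⊆ t.visited
  isAncestor_iff : ∀ a, ∀ w ∈ s.visited, (t.IsAncestor a w ↔ s.IsAncestor a w)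
  isAncestor_of_new : ∀ w ∈ t.visited, w ∉ s.visited → t.IsAncestor v w

lemma ExtendsBelow.trans {v : V} {s t t' : DFSState V} (h : ExtendsBelow v s t)
    (h' : ExtendsBelow v t t') : ExtendsBelow v s t' where
  consistent := h'.consistent
  subset := h.subset.trans h'.subset
  isAncestor_iff a w hw := by
    rw [h'.isAncestor_iff a w (h.subset hw), h.isAncestor_iff a w hw]
  isAncestor_of_new w hw hws := by
    by_cases hwt : w ∈ t.visited
    · rw [h'.isAncestor_iff v w hwt]
      exact h.isAncestor_of_new w hwt hws
    · exact h'.isAncestor_of_new w hw hwt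

lemma ExtendsBelow.of_addTree [DecidableEq V] {v u : V} {s t : DFSState V}
    (h : ExtendsBelow u (s.addTree v u) t) (hs : s.Consistent) (hv : v ∈ s.visited)
    (hu : u ∉ s.visited) : ExtendsBelow v s t where
  consistent := h.consistent
  subset := (Finset.subset_insert _ _).trans h.subset
  isAncestor_iff a w hw := by
    rw [h.isAncestor_iff a w (Finset.mem_insert_of_mem hw),
      hs.isAncestor_addTree_of_mem hv hu a hw]
  isAncestor_of_new w hw hws := by
    have hvu : t.IsAncestor v u := by
      rw [h.isAncestor_iff v u (Finset.mem_insert_self _ _), hs.isAncestor_addTree hv hu]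
      exact Or.inr ⟨rfl, Or.inl rfl⟩
    by_cases hwu : w = u
    · rwa [hwu]
    · exact hvu.trans (h.isAncestor_of_new w hw (by simp [hwu, hws]))

end DFSState

/-! ### Confinement and locality of the search -/

namespace Multidigraph

variable {V : Type*} [Fintype V] [DecidableEq V]

lemma exploreArcs_nil (G : Multidigraph V) (v : V) (s : DFSState V) :
    (G.exploreArcs v s []).1 = s := by
  rw [exploreArcs]

lemma exploreArcs_cons_of_mem (G : Multidigraph V) (v : V) (s : DFSState V) {u : V}
    (hu : u ∈ s.visited) (l : List V) :
    (G.exploreArcs v s (u :: l)).1 = (G.exploreArcs v (s.addNonTree v u) l).1 := by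
  rw [exploreArcs, dif_pos hu]

lemma exploreArcs_cons_of_notMem (G : Multidigraph V) (v : V) (s : DFSState V) {u : V}
    (hu : u ∉ s.visited) (l : List V) :
    (G.exploreArcs v s (u :: l)).1 =
      (G.exploreArcs v (G.exploreArcs u (s.addTree v u) (G u)).1 l).1 := by
  rw [exploreArcs, dif_neg hu]

/-- While the arcs of `v` are explored, new vertices only hang below `v`. Hence the depth of `v`
stays fixed and its number of descendants grows with the number of visited vertices. -/
lemma extendsBelow_exploreArcs (G : Multidigraph V) (v : V) (s : DFSState V) (l : List V)
    (hs : s.Consistent) (hv : v ∈ s.visited) :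
    DFSState.ExtendsBelow v s (G.exploreArcs v s l).1 := by
  induction v, s, l using exploreArcs.induct G with
  | case1 v s =>
    rw [exploreArcs_nil]
    exact ⟨hs, subset_rfl, fun _ _ _ => Iff.rfl, fun w hw hw' => absurd hw hw'⟩
  | case2 v s u l hu ih =>
    rw [exploreArcs_cons_of_mem _ _ _ hu]
    obtain ⟨h1, h2, h3, h4⟩ := ih (hs.addNonTree hv hu) hv
    refine ⟨h1, h2, fun a w hw => ?_, h4⟩
    rw [h3 a w hw]
    exact iff_of_eq (congrFun₂ (s.isAncestor_addNonTree v u) a w)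
  | case3 v s u l hu t ih1 _ ih2 =>
    rw [exploreArcs_cons_of_notMem _ _ _ hu]
    have h := (ih1 (hs.addTree hv hu) (Finset.mem_insert_self _ _)).of_addTree hs hv hu
    exact h.trans (ih2 h.consistent (h.subset hv))

/-- The search depends only on the arcs leaving the vertices that it newly visits. -/
lemma exploreArcs_congr (G G' : Multidigraph V) (v : V) (s : DFSState V) (l : List V)
    (h : ∀ u ∈ (G.exploreArcs v s l).1.visited, u ∉ s.visited → G u = G' u) :
    (G'.exploreArcs v s l).1 = (G.exploreArcs v s l).1 := by
  induction v, s, l using exploreArcs.induct G with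
  | case1 v s => rw [exploreArcs_nil, exploreArcs_nil]
  | case2 v s u l hu ih =>
    rw [exploreArcs_cons_of_mem _ _ _ hu] at h
    rw [exploreArcs_cons_of_mem _ _ _ hu, exploreArcs_cons_of_mem _ _ _ hu]
    exact ih h
  | case3 v s u l hu t ih1 _ ih2 =>
    rw [exploreArcs_cons_of_notMem _ _ _ hu] at h
    rw [exploreArcs_cons_of_notMem _ _ _ hu, exploreArcs_cons_of_notMem _ _ _ hu]
    have h1 := (G.exploreArcs u (s.addTree v u) (G u)).2
    have h2 := (G.exploreArcs v (G.exploreArcs u (s.addTree v u) (G u)).1 l).2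
    have hGu : G u = G' u := h u (h2 (h1 (Finset.mem_insert_self _ _))) hu
    rw [← hGu, ih1 fun w hw hw' => h w (h2 hw) fun hws => hw' (Finset.mem_insert_of_mem hws)]
    exact ih2 fun w hw hw' => h w hw fun hws => hw' (h1 (Finset.mem_insert_of_mem hws))

lemma exploreArcs_congr_of_notMem (G G' : Multidigraph V) (v : V) (s : DFSState V) (l : List V)
    (h : ∀ u ∉ s.visited, G u = G' u) :
    (G'.exploreArcs v s l).1 = (G.exploreArcs v s l).1 :=
  exploreArcs_congr G G' v s l fun u _ hu => h u hu

lemma dfsFrom_congr (G G' : Multidigraph V) (root : RootRule V) (s : DFSState V)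
    (h : ∀ u ∉ s.visited, G u = G' u) : G'.dfsFrom root s = G.dfsFrom root s := by
  induction s using dfsFrom.induct G root with
  | case1 s hs => rw [dfsFrom, dif_pos hs, dfsFrom, dif_pos hs]
  | case2 s hs ih =>
    rw [dfsFrom.eq_1 G' root s, dif_neg hs, dfsFrom.eq_1 G root s, dif_neg hs]
    have hr : (G'.visit (root s hs).1 s).1 = (G.visit (root s hs).1 s).1 := by
      unfold visit
      rw [← h _ (root s hs).2]
      exact exploreArcs_congr_of_notMem _ _ _ _ _ fun u hu =>
        h u fun hus => hu (Finset.mem_insert_of_mem hus)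
    rw [hr]
    exact ih fun u hu =>
      h u fun hus => hu ((G.visit (root s hs).1 s).2 (Finset.mem_insert_of_mem hus))

end Multidigraph

/-! ### Multiplicative weights of explored arcs -/

/-- Formal weights of the five kinds of arcs. -/
structure ArcWeights where
  loop : ℂ
  forward : ℂ
  back : ℂ
  cross : ℂ
  tree : ℂ

namespace ArcWeights

/-- All weights lie in the closed unit disc. -/
structure NormLeOne (x : ArcWeights) : Prop where
  loop : ‖x.loop‖ ≤ 1
  forward : ‖x.forward‖ ≤ 1
  back : ‖x.back‖ ≤ 1
  cross : ‖x.cross‖ ≤ 1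
  tree : ‖x.tree‖ ≤ 1

variable {V : Type*} (x : ArcWeights)

/-- The product of the weights of the arcs explored so far. -/
noncomputable def weight (s : DFSState V) : ℂ :=
  x.loop ^ s.numLoops * x.forward ^ s.numForward * x.back ^ s.numBack * x.cross ^ s.numCross *
    x.tree ^ s.numTree

open Classical in
/-- The weight of a non-tree arc `v → u` explored in the state `s`. -/
noncomputable def nonTreeWeight (s : DFSState V) (v u : V) : ℂ :=
  if u = v then x.loop else if s.IsAncestor v u then x.forward
  else if s.IsAncestor u v then x.back else x.cross

variable {x}

lemma NormLeOne.norm_weight_le (hx : x.NormLeOne) (s : DFSState V) : ‖x.weight s‖ ≤ 1 := by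
  unfold weight
  simp only [norm_mul, norm_pow]
  have h := fun (z : ℂ) (hz : ‖z‖ ≤ 1) (n : ℕ) => pow_le_one₀ (n := n) (norm_nonneg z) hz
  refine mul_le_one₀ (mul_le_one₀ (mul_le_one₀ (mul_le_one₀ (h _ hx.loop _) (by positivity)
    (h _ hx.forward _)) (by positivity) (h _ hx.back _)) (by positivity) (h _ hx.cross _))
    (by positivity) (h _ hx.tree _)

lemma NormLeOne.norm_nonTreeWeight_le (hx : x.NormLeOne) (s : DFSState V) (v u : V) :
    ‖x.nonTreeWeight s v u‖ ≤ 1 := by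
  unfold nonTreeWeight
  split_ifs
  exacts [hx.loop, hx.forward, hx.back, hx.cross]

variable (x)

lemma weight_init : x.weight (⟨∅, []⟩ : DFSState V) = 1 := by
  simp [weight, DFSState.numLoops, DFSState.numForward, DFSState.numBack, DFSState.numCross,
    DFSState.numTree]

lemma weight_addRoot [DecidableEq V] (s : DFSState V) (v : V) :
    x.weight (s.addRoot v) = x.weight s := rfl

/-- Acyclicity makes the types loop, forward and back mutually exclusive, so exactly one count
increases. -/
lemma weight_addNonTree {s : DFSState V} (hs : s.Consistent) (v u : V) :
    x.weight (s.addNonTree v u) = x.nonTreeWeight s v u * x.weight s := by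
  classical
  have hL : (s.addNonTree v u).IsLoop = s.IsLoop := rfl
  have hF : (s.addNonTree v u).IsForward = s.IsForward := by
    ext a; simp only [DFSState.IsForward, s.isAncestor_addNonTree]
  have hB : (s.addNonTree v u).IsBack = s.IsBack := by
    ext a; simp only [DFSState.IsBack, s.isAncestor_addNonTree]
  have hC : (s.addNonTree v u).IsCross = s.IsCross := by
    ext a; simp only [DFSState.IsCross, hL, hF, hB]
  unfold weight nonTreeWeight DFSState.numLoops DFSState.numForward DFSState.numBack
    DFSState.numCross DFSState.numTree
  rw [hL, hF, hB, hC]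
  simp only [List.countP_cons]
  have h1 := hs.acyclic v
  have h2 := fun h : s.IsAncestor v u => hs.not_isAncestor_symm h
  by_cases huv : u = v
  · subst huv
    simp [DFSState.IsLoop, DFSState.IsForward, DFSState.IsBack, DFSState.IsCross, h1, pow_succ]
    ring
  · by_cases hvu : s.IsAncestor v u
    · simp [DFSState.IsLoop, DFSState.IsForward, DFSState.IsBack, DFSState.IsCross, huv, hvu,
        h2 hvu, pow_succ]
      ring
    · by_cases huv' : s.IsAncestor u v
      · simp [DFSState.IsLoop, DFSState.IsForward, DFSState.IsBack, DFSState.IsCross, huv, hvu,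
          huv', pow_succ]
        ring
      · simp [DFSState.IsLoop, DFSState.IsForward, DFSState.IsBack, DFSState.IsCross, huv, hvu,
          huv', pow_succ]
        ring

/-- Earlier arcs have both ends among the vertices visited before `u`, where a new leaf does not
alter ancestry; so they keep their types. -/
lemma weight_addTree [DecidableEq V] {s : DFSState V} (hs : s.Consistent) {v u : V}
    (hv : v ∈ s.visited) (hu : u ∉ s.visited) :
    x.weight (s.addTree v u) = x.tree * x.weight s := by
  classical
  have hL : ∀ a ∈ s.explored, ((s.addTree v u).IsLoop a ↔ s.IsLoop a) := fun _ _ => Iff.rfl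
  have hF : ∀ a ∈ s.explored, ((s.addTree v u).IsForward a ↔ s.IsForward a) := fun a ha => by
    simp only [DFSState.IsForward, hs.isAncestor_addTree_of_mem hv hu _ (hs.head_mem a ha)]
  have hB : ∀ a ∈ s.explored, ((s.addTree v u).IsBack a ↔ s.IsBack a) := fun a ha => by
    simp only [DFSState.IsBack, hs.isAncestor_addTree_of_mem hv hu _ (hs.tail_mem a ha)]
  have hC : ∀ a ∈ s.explored, ((s.addTree v u).IsCross a ↔ s.IsCross a) := fun a ha => by
    simp only [DFSState.IsCross, hL a ha, hF a ha, hB a ha]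
  have key : ∀ {P Q : ExploredArc V → Prop}, (∀ a ∈ s.explored, (P a ↔ Q a)) →
      ¬ P ⟨v, u, true⟩ →
      List.countP (fun a => decide (P a)) (⟨v, u, true⟩ :: s.explored) =
        List.countP (fun a => decide (Q a)) s.explored := by
    intro P Q h h'
    rw [List.countP_cons_of_neg (by simpa using h')]
    exact List.countP_congr fun a ha => by simpa using h a ha
  unfold weight DFSState.numLoops DFSState.numForward DFSState.numBack DFSState.numCross
    DFSState.numTree
  rw [key hL (by simp [DFSState.IsLoop]), key hF (by simp [DFSState.IsForward]),
    key hB (by simp [DFSState.IsBack]), key hC (by simp [DFSState.IsCross]),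
    List.countP_cons_of_pos rfl]
  ring

end ArcWeights

/-! ### Counting visited vertices by kinship with the current one -/

namespace DFSState

variable {V : Type*} [Fintype V]

open Classical in
/-- The number of proper ancestors of `v`. -/
noncomputable def depth (s : DFSState V) (v : V) : ℕ :=
  (Finset.univ.filter fun a => s.IsAncestor a v).card

open Classical in
/-- The number of proper descendants of `v`. -/
noncomputable def numDesc (s : DFSState V) (v : V) : ℕ :=
  (Finset.univ.filter fun w => s.IsAncestor v w).card

lemma depth_addNonTree (s : DFSState V) (v u w : V) :
    (s.addNonTree v u).depth w = s.depth w := by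
  unfold depth
  congr 1
  ext a
  simp [isAncestor_addNonTree]

lemma numDesc_addNonTree (s : DFSState V) (v u w : V) :
    (s.addNonTree v u).numDesc w = s.numDesc w := by
  unfold numDesc
  congr 1
  ext a
  simp [isAncestor_addNonTree]

lemma Consistent.depth_addRoot [DecidableEq V] {s : DFSState V} (hs : s.Consistent) {v : V}
    (hv : v ∉ s.visited) : (s.addRoot v).depth v = 0 := by
  change s.depth v = 0
  simp only [depth, Finset.card_eq_zero, Finset.filter_eq_empty_iff]
  exact fun a _ h => hv (hs.head_mem_of_isAncestor h)

lemma Consistent.numDesc_of_notMem {s : DFSState V} (hs : s.Consistent) {v : V}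
    (hv : v ∉ s.visited) : s.numDesc v = 0 := by
  simp only [numDesc, Finset.card_eq_zero, Finset.filter_eq_empty_iff]
  exact fun a _ h => hv (hs.tail_mem_of_isAncestor h)

lemma Consistent.depth_addTree [DecidableEq V] {s : DFSState V} (hs : s.Consistent) {v u : V}
    (hv : v ∈ s.visited) (hu : u ∉ s.visited) : (s.addTree v u).depth u = s.depth v + 1 := by
  classical
  unfold depth
  rw [← Finset.card_insert_of_notMem (a := v)
    (s := Finset.univ.filter fun a => s.IsAncestor a v) (by simpa using hs.acyclic v)]
  congr 1
  ext a
  have : ¬ s.IsAncestor a u := fun h => hu (hs.head_mem_of_isAncestor h)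
  simp [hs.isAncestor_addTree hv hu, this]

lemma Consistent.numDesc_addTree [DecidableEq V] {s : DFSState V} (hs : s.Consistent) {v u : V}
    (hv : v ∈ s.visited) (hu : u ∉ s.visited) : (s.addTree v u).numDesc u = 0 := by
  simp only [numDesc, Finset.card_eq_zero, Finset.filter_eq_empty_iff]
  intro a _ h
  rcases (hs.isAncestor_addTree hv hu u a).1 h with h | ⟨_, h | h⟩
  · exact hu (hs.tail_mem_of_isAncestor h)
  · exact hu (h ▸ hv)
  · exact hu (hs.tail_mem_of_isAncestor h)

lemma ExtendsBelow.depth_eq {v : V} {s t : DFSState V} (h : ExtendsBelow v s t) {w : V}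
    (hw : w ∈ s.visited) : t.depth w = s.depth w := by
  unfold depth
  congr 1
  ext a
  simp [h.isAncestor_iff a w hw]

/-- The newly visited vertices are exactly the new descendants of `v`. The additive form avoids
truncated subtraction. -/
lemma ExtendsBelow.numDesc_add {v : V} {s t : DFSState V} (h : ExtendsBelow v s t)
    (hs : s.Consistent) :
    t.numDesc v + s.visited.card = s.numDesc v + t.visited.card := by
  classical
  have : (Finset.univ.filter fun w => t.IsAncestor v w) =
      (Finset.univ.filter fun w => s.IsAncestor v w) ∪ (t.visited \ s.visited) := by
    ext w
    simp only [Finset.mem_filter, Finset.mem_univ, true_and, Finset.mem_union, Finset.mem_sdiff]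
    by_cases hw : w ∈ s.visited
    · simp [h.isAncestor_iff v w hw, hw]
    · have h1 : ¬ s.IsAncestor v w := fun h' => hw (hs.head_mem_of_isAncestor h')
      simp only [h1, hw, not_false_eq_true, and_true, false_or]
      exact ⟨fun h' => h.consistent.head_mem_of_isAncestor h', fun h' => h.isAncestor_of_new w h' hw⟩
  unfold numDesc
  rw [this, Finset.card_union_of_disjoint, Finset.card_sdiff_of_subset h.subset]
  · have := Finset.card_le_card h.subset
    omega
  · rw [Finset.disjoint_left]
    intro w hw hw'
    simp only [Finset.mem_filter, Finset.mem_univ, true_and] at hw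
    exact (Finset.mem_sdiff.1 hw').2 (hs.head_mem_of_isAncestor hw)

open Classical in
lemma Consistent.sum_visited {M : Type*} [AddCommMonoid M] {s : DFSState V} (hs : s.Consistent)
    {v : V} (hv : v ∈ s.visited) (f : V → M) :
    ∑ u ∈ s.visited, f u = f v + ∑ u with s.IsAncestor v u, f u + ∑ u with s.IsAncestor u v, f u +
      ∑ u ∈ s.visited with u ≠ v ∧ ¬ s.IsAncestor v u ∧ ¬ s.IsAncestor u v, f u := by
  have e1 : s.visited.filter (fun u => u = v) = {v} := by
    ext u; simp only [Finset.mem_filter, Finset.mem_singleton]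
    exact ⟨fun h => h.2, fun h => ⟨h ▸ hv, h⟩⟩
  have e2 : (s.visited.filter (fun u => ¬ u = v)).filter (fun u => s.IsAncestor v u) =
      Finset.univ.filter fun u => s.IsAncestor v u := by
    ext u; simp only [Finset.mem_filter, Finset.mem_univ, true_and]
    exact ⟨fun h => h.2, fun h => ⟨⟨hs.head_mem_of_isAncestor h,
      fun h' => hs.acyclic v (by rwa [h'] at h)⟩, h⟩⟩
  have e3 : ((s.visited.filter (fun u => ¬ u = v)).filter (fun u => ¬ s.IsAncestor v u)).filter
      (fun u => s.IsAncestor u v) = Finset.univ.filter fun u => s.IsAncestor u v := by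
    ext u; simp only [Finset.mem_filter, Finset.mem_univ, true_and]
    exact ⟨fun h => h.2, fun h => ⟨⟨⟨hs.tail_mem_of_isAncestor h,
      fun h' => hs.acyclic v (by rwa [h'] at h)⟩, hs.not_isAncestor_symm h⟩, h⟩⟩
  rw [← Finset.sum_filter_add_sum_filter_not s.visited (fun u => u = v), e1, Finset.sum_singleton,
    ← Finset.sum_filter_add_sum_filter_not (s.visited.filter _) (fun u => s.IsAncestor v u), e2,
    ← Finset.sum_filter_add_sum_filter_not ((s.visited.filter _).filter _)
      (fun u => s.IsAncestor u v), e3]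
  simp only [Finset.filter_filter, ne_eq, and_assoc, add_assoc]

open Classical in
lemma Consistent.card_visited {s : DFSState V} (hs : s.Consistent) {v : V} (hv : v ∈ s.visited) :
    s.visited.card = 1 + s.numDesc v + s.depth v +
      (s.visited.filter fun u => u ≠ v ∧ ¬ s.IsAncestor v u ∧ ¬ s.IsAncestor u v).card := by
  unfold numDesc depth
  simp only [Finset.card_eq_sum_ones]
  exact hs.sum_visited hv (fun _ => 1)

/-- The total weight of one non-tree step sees the state only through three numbers, which is why
the search reduces to `treeSum`. -/
lemma Consistent.sum_nonTreeWeight {s : DFSState V} (hs : s.Consistent) {v : V}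
    (hv : v ∈ s.visited) (x : ArcWeights) :
    ∑ u ∈ s.visited, x.nonTreeWeight s v u = x.loop + s.numDesc v * x.forward +
      s.depth v * x.back + (s.visited.card - 1 - s.numDesc v - s.depth v) * x.cross := by
  classical
  have h0 : x.nonTreeWeight s v v = x.loop := by simp [ArcWeights.nonTreeWeight]
  have h1 : ∀ u ∈ Finset.univ.filter fun u => s.IsAncestor v u,
      x.nonTreeWeight s v u = x.forward := by
    intro u hu
    simp only [Finset.mem_filter, Finset.mem_univ, true_and] at hu
    have : u ≠ v := fun h => hs.acyclic v (by rwa [h] at hu)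
    simp [ArcWeights.nonTreeWeight, this, hu]
  have h2 : ∀ u ∈ Finset.univ.filter fun u => s.IsAncestor u v,
      x.nonTreeWeight s v u = x.back := by
    intro u hu
    simp only [Finset.mem_filter, Finset.mem_univ, true_and] at hu
    have : u ≠ v := fun h => hs.acyclic v (by rwa [h] at hu)
    simp [ArcWeights.nonTreeWeight, this, hu, hs.not_isAncestor_symm hu]
  have h3 : ∀ u ∈ s.visited.filter fun u => u ≠ v ∧ ¬ s.IsAncestor v u ∧ ¬ s.IsAncestor u v,
      x.nonTreeWeight s v u = x.cross := by
    intro u hu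
    simp only [Finset.mem_filter] at hu
    simp [ArcWeights.nonTreeWeight, hu]
  rw [hs.sum_visited hv, h0, Finset.sum_congr rfl h1, Finset.sum_congr rfl h2,
    Finset.sum_congr rfl h3, hs.card_visited hv]
  simp only [Finset.sum_const, nsmul_eq_mul, depth, numDesc]
  push_cast
  ring

end DFSState

/-! ### Plane trees weighted along the walk around them -/

open Finset in
lemma Finset.Nat.sum_antidiagonal_fst_antidiagonal {M : Type*} [AddCommMonoid M] (n : ℕ)
    (f : ℕ → ℕ → ℕ → M) :
    ∑ p ∈ HasAntidiagonal.antidiagonal n, ∑ q ∈ HasAntidiagonal.antidiagonal p.1, f q.1 q.2 p.2 =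
      ∑ p ∈ HasAntidiagonal.antidiagonal n, ∑ q ∈ HasAntidiagonal.antidiagonal p.2, f p.1 q.1 q.2 := by
  simp only [Finset.sum_sigma']
  apply Finset.sum_nbij' (fun ⟨⟨_i, j⟩, ⟨k, l⟩⟩ ↦ ⟨(k, l + j), (l, j)⟩)
    (fun ⟨⟨i, _j⟩, ⟨k, l⟩⟩ ↦ ⟨(i + k, l), (i, k)⟩) <;>
    simp only [Finset.mem_sigma, HasAntidiagonal.mem_antidiagonal, Sigma.forall, Prod.forall, Sigma.mk.injEq,
      heq_eq_eq, Prod.mk.injEq] <;>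
    grind

/-- The generating function of the plane trees with `k + 1` vertices, with respect to weights of the
positions of a walk around the tree: `w N d D` is the weight of a position at a vertex with `d`
proper ancestors, and `D` proper descendants visited so far, when `N` vertices have been visited.
The walk starts at the root, at a position with the given values of `N`, `d` and `D`. -/
noncomputable def treeSum (w : ℕ → ℕ → ℕ → ℂ) : ℕ → ℕ → ℕ → ℕ → ℂ
  | 0, N, d, D => w N d D
  | k + 1, N, d, D => w N d D * ∑ p ∈ (Finset.HasAntidiagonal.antidiagonal k).attach,
      treeSum w p.1.1 (N + 1) (d + 1) 0 * treeSum w p.1.2 (N + 1 + p.1.1) d (D + 1 + p.1.1)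
termination_by k => k
decreasing_by
  all_goals
    have := Finset.HasAntidiagonal.mem_antidiagonal.1 p.2
    omega

namespace treeSum

open Finset

variable (w : ℕ → ℕ → ℕ → ℂ)

lemma zero (N d D : ℕ) : treeSum w 0 N d D = w N d D := by rw [treeSum]

/-- Decomposition of a plane tree at the first child of the root. -/
lemma succ (k N d D : ℕ) : treeSum w (k + 1) N d D = w N d D * ∑ p ∈ HasAntidiagonal.antidiagonal k,
    treeSum w p.1 (N + 1) (d + 1) 0 * treeSum w p.2 (N + 1 + p.1) d (D + 1 + p.1) := by
  rw [treeSum, Finset.sum_attach (HasAntidiagonal.antidiagonal k) fun p =>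
    treeSum w p.1 (N + 1) (d + 1) 0 * treeSum w p.2 (N + 1 + p.1) d (D + 1 + p.1)]

/-- Decomposition of a plane tree at the last child of the root. -/
lemma succ' (k N d D : ℕ) : treeSum w (k + 1) N d D =
    w (N + k + 1) d (D + k + 1) * ∑ p ∈ HasAntidiagonal.antidiagonal k,
      treeSum w p.1 N d D * treeSum w p.2 (N + 1 + p.1) (d + 1) 0 := by
  induction k using Nat.strong_induction_on generalizing N d D with
  | _ k ih =>
    rw [succ]
    rcases k with _ | m
    · simp [zero]; ring
    · rw [Nat.sum_antidiagonal_succ', Nat.sum_antidiagonal_succ]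
      simp only [zero, add_zero]
      -- Here the last child is split off from what follows the first child; in `h2` the first child
      -- is split off from what precedes the last. Both give a triple sum over first subtree, middle
      -- part and last subtree. The isolated boundary terms are the trees whose root has one child.
      have h1 : ∀ p ∈ HasAntidiagonal.antidiagonal m,
          treeSum w p.1 (N + 1) (d + 1) 0 * treeSum w (p.2 + 1) (N + 1 + p.1) d (D + 1 + p.1) =
          w (N + (m + 1) + 1) d (D + (m + 1) + 1) * ∑ q ∈ HasAntidiagonal.antidiagonal p.2,
            treeSum w p.1 (N + 1) (d + 1) 0 * treeSum w q.1 (N + 1 + p.1) d (D + 1 + p.1) *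
              treeSum w q.2 (N + 1 + (p.1 + q.1 + 1)) (d + 1) 0 := by
        intro p hp
        have hp' := HasAntidiagonal.mem_antidiagonal.1 hp
        rw [ih p.2 (by omega), mul_left_comm, mul_sum]
        congr 1
        · congr 1 <;> omega
        · refine sum_congr rfl fun q _ => ?_
          rw [mul_assoc]
          congr 3
          omega
      have h2 : ∀ p ∈ HasAntidiagonal.antidiagonal m,
          treeSum w (p.1 + 1) N d D * treeSum w p.2 (N + 1 + (p.1 + 1)) (d + 1) 0 =
          w N d D * ∑ q ∈ HasAntidiagonal.antidiagonal p.1,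
            treeSum w q.1 (N + 1) (d + 1) 0 * treeSum w q.2 (N + 1 + q.1) d (D + 1 + q.1) *
              treeSum w p.2 (N + 1 + (q.1 + q.2 + 1)) (d + 1) 0 := by
        intro p _
        rw [succ, mul_assoc, sum_mul]
        congr 1
        refine sum_congr rfl fun q hq => ?_
        rw [HasAntidiagonal.mem_antidiagonal.1 hq]
      rw [sum_congr rfl h1, sum_congr rfl h2, ← mul_sum, ← mul_sum,
        Nat.sum_antidiagonal_fst_antidiagonal m fun i a b =>
          treeSum w i (N + 1) (d + 1) 0 * treeSum w a (N + 1 + i) d (D + 1 + i) *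
              treeSum w b (N + 1 + (i + a + 1)) (d + 1) 0]
      have e : w (N + 1 + (m + 1)) d (D + 1 + (m + 1)) =
          w (N + (m + 1) + 1) d (D + (m + 1) + 1) := by congr 1 <;> omega
      rw [e]
      ring

variable {w}

/-- For descendant weights, this lets the subtree of a child be treated as a tree at depth `0`. -/
lemma congr_depth (hw : ∀ N d d' D, w N d D = w N d' D) (k N d d' D : ℕ) :
    treeSum w k N d D = treeSum w k N d' D := by
  induction k using Nat.strong_induction_on generalizing N d d' D with
  | _ k ih =>
    rcases k with _ | m
    · rw [zero, zero, hw N d d' D]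
    · rw [succ, succ, hw N d d' D]
      congr 1
      refine sum_congr rfl fun p hp => ?_
      have := HasAntidiagonal.mem_antidiagonal.1 hp
      rw [ih p.1 (by omega) _ (d + 1) (d' + 1), ih p.2 (by omega) _ d d']

end treeSum

/-! ### Exchanging depth and number of descendants -/

/-- A solution of the recursion for plane trees whose positions are weighted, according to the depth
`d` and the number `N` of vertices visited so far, by the inverse of `a - γ N - β d`. -/
structure DepthRecursion (n : ℕ) (a γ β : ℂ) (ℓ : ℕ → ℕ → ℕ → ℂ) : Prop where
  ne_zero : ∀ {N d : ℕ}, d < N → N ≤ n → a - γ * N - β * d ≠ 0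
  zero : ∀ {N d : ℕ}, d < N → N ≤ n → (a - γ * N - β * d) * ℓ 0 N d = 1
  succ : ∀ {k N d : ℕ}, d < N → N + k + 1 ≤ n → (a - γ * (N + k + 1 : ℕ) - β * d) * ℓ (k + 1) N d =
    ∑ p ∈ Finset.HasAntidiagonal.antidiagonal k, ℓ p.1 N d * ℓ p.2 (N + 1 + p.1) (d + 1)

namespace DepthRecursion

open Finset

variable {n : ℕ} {a γ β : ℂ} {ℓ : ℕ → ℕ → ℕ → ℂ}

/-- The shift from `(N, d)` to `(N + 1, d + 1)` lowers each denominator by `γ + β`. The recursion at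
both places, multiplied out by the final denominator, reduces the claim to smaller trees by a
discrete product rule. -/
lemma sub_eq_sum (h : DepthRecursion n a γ β ℓ) (j : ℕ) {N d : ℕ} (hd : d < N)
    (hN : N + 1 + j ≤ n) :
    ℓ j (N + 1) (d + 1) - ℓ j N d = (γ + β) * ∑ p ∈ HasAntidiagonal.antidiagonal j,
      (p.2 + 1) * (ℓ p.1 N d * ℓ p.2 (N + 1 + p.1) (d + 1)) := by
  induction j using Nat.strong_induction_on generalizing N d with
  | _ j ih =>
    rcases j with _ | k
    · have h1 := h.zero hd (by omega)
      have h2 := h.zero (N := N + 1) (d := d + 1) (by omega) (by omega)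
      simp only [Finset.Nat.antidiagonal_zero, sum_singleton, add_zero]
      push_cast at h2 ⊢
      linear_combination ℓ 0 N d * h2 - (ℓ 0 (N + 1) (d + 1)) * h1
    · refine mul_left_cancel₀ (h.ne_zero (N := N + 1 + k + 1) (d := d + 1) (by omega) (by omega)) ?_
      have h1 := h.succ (k := k) hd (by omega)
      have h2 := h.succ (k := k) (N := N + 1) (d := d + 1) (by omega) (by omega)
      -- Product rule, with the induction hypothesis applied to each factor.
      have e1 : ∀ p ∈ HasAntidiagonal.antidiagonal k, ℓ p.1 (N + 1) (d + 1) * ℓ p.2 (N + 1 + 1 + p.1) (d + 1 + 1) -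
          ℓ p.1 N d * ℓ p.2 (N + 1 + p.1) (d + 1) =
          (γ + β) * ∑ q ∈ HasAntidiagonal.antidiagonal p.1, (q.2 + 1) * (ℓ q.1 N d * ℓ q.2 (N + 1 + q.1) (d + 1) *
              ℓ p.2 (N + 2 + (q.1 + q.2)) (d + 2)) +
          (γ + β) * ∑ q ∈ HasAntidiagonal.antidiagonal p.2, (q.2 + 1) *
            (ℓ p.1 N d * ℓ q.1 (N + 1 + p.1) (d + 1) * ℓ q.2 (N + 2 + (p.1 + q.1)) (d + 2)) := by
        intro p hp
        have hp' := HasAntidiagonal.mem_antidiagonal.1 hp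
        have i1 := ih p.1 (by omega) hd (by omega)
        have i2 := ih p.2 (by omega) (N := N + 1 + p.1) (d := d + 1) (by omega) (by omega)
        have s1 : ∑ q ∈ HasAntidiagonal.antidiagonal p.1, ((q.2 : ℂ) + 1) *
            (ℓ q.1 N d * ℓ q.2 (N + 1 + q.1) (d + 1) * ℓ p.2 (N + 2 + (q.1 + q.2)) (d + 2)) =
            (∑ q ∈ HasAntidiagonal.antidiagonal p.1, (q.2 + 1) * (ℓ q.1 N d * ℓ q.2 (N + 1 + q.1) (d + 1))) *
              ℓ p.2 (N + 2 + p.1) (d + 2) := by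
          rw [sum_mul]
          refine sum_congr rfl fun q hq => ?_
          rw [HasAntidiagonal.mem_antidiagonal.1 hq]; ring
        have s2 : ∑ q ∈ HasAntidiagonal.antidiagonal p.2, ((q.2 : ℂ) + 1) *
            (ℓ p.1 N d * ℓ q.1 (N + 1 + p.1) (d + 1) * ℓ q.2 (N + 2 + (p.1 + q.1)) (d + 2)) =
            ℓ p.1 N d * ∑ q ∈ HasAntidiagonal.antidiagonal p.2, (q.2 + 1) *
              (ℓ q.1 (N + 1 + p.1) (d + 1) * ℓ q.2 (N + 1 + p.1 + 1 + q.1) (d + 1 + 1)) := by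
          rw [mul_sum]
          refine sum_congr rfl fun q hq => ?_
          rw [show N + 1 + p.1 + 1 + q.1 = N + 2 + (p.1 + q.1) by omega]; ring
        rw [s1, s2]
        rw [show N + 1 + p.1 + 1 = N + 2 + p.1 by omega] at i2
        rw [show N + 1 + 1 + p.1 = N + 2 + p.1 by omega]
        rw [show N + 1 + p.1 + 1 = N + 2 + p.1 by omega]
        linear_combination (ℓ p.2 (N + 2 + p.1) (d + 2)) * i1 + ℓ p.1 N d * i2
      -- The final denominator is the same for every `p`, as all vertices have then been visited.
      -- The coefficient `p.2 + 2` splits as `(q.1 + 1) + (q.2 + 1)`, matching the two sums of `e1`.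
      have e2 : ∀ p ∈ HasAntidiagonal.antidiagonal k, (a - γ * (N + 1 + k + 1 : ℕ) - β * (d + 1 : ℕ)) *
          (((p.2 + 1 : ℕ) + 1) * (ℓ p.1 N d * ℓ (p.2 + 1) (N + 1 + p.1) (d + 1))) =
          ∑ q ∈ HasAntidiagonal.antidiagonal p.2, (q.1 + q.2 + 2) * (ℓ p.1 N d * ℓ q.1 (N + 1 + p.1) (d + 1) *
            ℓ q.2 (N + 2 + (p.1 + q.1)) (d + 2)) := by
        intro p hp
        have hp' := HasAntidiagonal.mem_antidiagonal.1 hp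
        have i := h.succ (k := p.2) (N := N + 1 + p.1) (d := d + 1) (by omega) (by omega)
        rw [show N + 1 + p.1 + p.2 + 1 = N + 1 + k + 1 by omega] at i
        have s : ∑ q ∈ HasAntidiagonal.antidiagonal p.2, ((q.1 : ℂ) + q.2 + 2) * (ℓ p.1 N d *
            ℓ q.1 (N + 1 + p.1) (d + 1) * ℓ q.2 (N + 2 + (p.1 + q.1)) (d + 2)) =
            ((p.2 + 1 : ℕ) + 1) * ℓ p.1 N d * ∑ q ∈ HasAntidiagonal.antidiagonal p.2,
              ℓ q.1 (N + 1 + p.1) (d + 1) * ℓ q.2 (N + 1 + p.1 + 1 + q.1) (d + 1 + 1) := by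
          rw [mul_sum]
          refine sum_congr rfl fun q hq => ?_
          rw [← HasAntidiagonal.mem_antidiagonal.1 hq, show N + 1 + p.1 + 1 + q.1 = N + 2 + (p.1 + q.1) by omega]
          push_cast; ring
        rw [s, ← i]; ring
      -- The term with `p.2 = 0` gives `(γ + β) * ℓ (k + 1) N d`, which offsets the difference of
      -- the two final denominators.
      have e3 := h.zero (N := N + 1 + k + 1) (d := d + 1) (by omega) (by omega)
      have t1 := Nat.sum_antidiagonal_fst_antidiagonal k fun i a b => ((a : ℂ) + 1) *
        (ℓ i N d * ℓ a (N + 1 + i) (d + 1) * ℓ b (N + 2 + (i + a)) (d + 2))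
      have t2 : ∑ p ∈ HasAntidiagonal.antidiagonal k, ∑ q ∈ HasAntidiagonal.antidiagonal p.2, ((q.1 : ℂ) + q.2 + 2) *
            (ℓ p.1 N d * ℓ q.1 (N + 1 + p.1) (d + 1) * ℓ q.2 (N + 2 + (p.1 + q.1)) (d + 2)) =
          ∑ p ∈ HasAntidiagonal.antidiagonal k, ∑ q ∈ HasAntidiagonal.antidiagonal p.2, ((q.1 : ℂ) + 1) *
            (ℓ p.1 N d * ℓ q.1 (N + 1 + p.1) (d + 1) * ℓ q.2 (N + 2 + (p.1 + q.1)) (d + 2)) +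
          ∑ p ∈ HasAntidiagonal.antidiagonal k, ∑ q ∈ HasAntidiagonal.antidiagonal p.2, ((q.2 : ℂ) + 1) *
            (ℓ p.1 N d * ℓ q.1 (N + 1 + p.1) (d + 1) * ℓ q.2 (N + 2 + (p.1 + q.1)) (d + 2)) := by
        simp only [← sum_add_distrib]
        refine sum_congr rfl fun p _ => sum_congr rfl fun q _ => ?_
        ring
      have t3 := sum_congr rfl e1
      rw [sum_sub_distrib, sum_add_distrib, ← mul_sum, ← mul_sum] at t3
      have t4 := sum_congr rfl e2
      rw [← mul_sum] at t4
      rw [Nat.sum_antidiagonal_succ']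
      simp only [Nat.cast_zero, zero_add, one_mul]
      rw [show N + 1 + (k + 1) = N + 1 + k + 1 by omega]
      push_cast at *
      linear_combination h2 - h1 + t3 + (γ + β) * t1 - (γ + β) * t4 - (γ + β) * t2 -
        (γ + β) * ℓ (k + 1) N d * e3

/-- This is the recursion for descendant weights, satisfied by the depth solution. After
multiplication by the depth denominator, the second factors on the right expand by `h.succ`;
regrouping makes the induction hypothesis apply to the first two factors. -/
lemma succ_desc (h : DepthRecursion n a γ β ℓ) (k : ℕ) {N d : ℕ} (hd : d < N)
    (hN : N + k + 1 ≤ n) :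
    (a - γ * (N + k + 1 : ℕ) - β * (d + k + 1 : ℕ)) * ℓ (k + 1) N d =
      ∑ p ∈ HasAntidiagonal.antidiagonal k, ℓ p.1 N d * ℓ p.2 (N + 1 + p.1) d := by
  induction k using Nat.strong_induction_on generalizing N d with
  | _ k ih =>
    refine mul_left_cancel₀ (h.ne_zero (N := N + k + 1) (d := d) (by omega) (by omega)) ?_
    have hY := h.succ (k := k) hd hN
    rcases k with _ | m
    · have h1 := h.zero (N := N + 1) (d := d) (by omega) (by omega)
      have h2 := h.zero (N := N + 1) (d := d + 1) (by omega) (by omega)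
      simp only [Finset.Nat.antidiagonal_zero, sum_singleton, add_zero] at hY ⊢
      push_cast at *
      linear_combination (a - γ * (N + 1) - β * (d + 1)) * hY + ℓ 0 N d * h2 - ℓ 0 N d * h1
    · have hZ := h.sub_eq_sum (m + 1) hd (by omega)
      rw [Nat.sum_antidiagonal_succ] at hZ
      rw [Nat.sum_antidiagonal_succ] at hY
      rw [Nat.sum_antidiagonal_succ']
      have e0 := h.zero (N := N) (d := d) hd (by omega)
      have e1 := h.zero (N := N + 1 + (m + 1)) (d := d) (by omega) (by omega)
      have e2 : ∀ p ∈ HasAntidiagonal.antidiagonal m, (a - γ * (N + (m + 1) + 1 : ℕ) - β * d) *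
          (ℓ p.1 N d * ℓ (p.2 + 1) (N + 1 + p.1) d) = ∑ q ∈ HasAntidiagonal.antidiagonal p.2,
            ℓ p.1 N d * ℓ q.1 (N + 1 + p.1) d * ℓ q.2 (N + 2 + (p.1 + q.1)) (d + 1) := by
        intro p hp
        have hp' := HasAntidiagonal.mem_antidiagonal.1 hp
        have i := h.succ (k := p.2) (N := N + 1 + p.1) (d := d) (by omega) (by omega)
        rw [show N + 1 + p.1 + p.2 + 1 = N + (m + 1) + 1 by omega] at i
        rw [mul_left_comm, i, mul_sum]
        refine sum_congr rfl fun q hq => ?_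
        rw [show N + 1 + p.1 + 1 + q.1 = N + 2 + (p.1 + q.1) by omega]; ring
      -- The induction hypothesis comes with `p.1 + 1` new vertices instead of `m + 2`. The
      -- shortfall `p.2 + 1`, in both the `γ` and the `β` term, is the coefficient that `hZ` sums.
      have e3 : ∀ p ∈ HasAntidiagonal.antidiagonal m, ∑ q ∈ HasAntidiagonal.antidiagonal p.1,
            ℓ q.1 N d * ℓ q.2 (N + 1 + q.1) d * ℓ p.2 (N + 2 + (q.1 + q.2)) (d + 1) =
          (a - γ * (N + (m + 1) + 1 : ℕ) - β * (d + (m + 1) + 1 : ℕ)) *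
            (ℓ (p.1 + 1) N d * ℓ p.2 (N + 1 + (p.1 + 1)) (d + 1)) +
          (γ + β) * ((p.2 + 1) * (ℓ (p.1 + 1) N d * ℓ p.2 (N + 1 + (p.1 + 1)) (d + 1))) := by
        intro p hp
        have hp' := HasAntidiagonal.mem_antidiagonal.1 hp
        have i := ih p.1 (by omega) hd (by omega)
        have s : ∑ q ∈ HasAntidiagonal.antidiagonal p.1,
            ℓ q.1 N d * ℓ q.2 (N + 1 + q.1) d * ℓ p.2 (N + 2 + (q.1 + q.2)) (d + 1) =
            (∑ q ∈ HasAntidiagonal.antidiagonal p.1, ℓ q.1 N d * ℓ q.2 (N + 1 + q.1) d) *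
              ℓ p.2 (N + 1 + (p.1 + 1)) (d + 1) := by
          rw [sum_mul]
          refine sum_congr rfl fun q hq => ?_
          rw [HasAntidiagonal.mem_antidiagonal.1 hq, show N + 2 + p.1 = N + 1 + (p.1 + 1) by omega]
        rw [s, ← i, ← hp']
        push_cast
        ring
      have t1 := Nat.sum_antidiagonal_fst_antidiagonal m fun i a b =>
        (ℓ i N d * ℓ a (N + 1 + i) d * ℓ b (N + 2 + (i + a)) (d + 1))
      have t2 := sum_congr rfl e2
      have t3 := sum_congr rfl e3
      rw [← mul_sum] at t2
      rw [sum_add_distrib, ← mul_sum, ← mul_sum] at t3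
      simp only [add_zero] at *
      push_cast at *
      linear_combination (a - γ * (N + (m + 1) + 1) - β * (d + (m + 1) + 1)) * hY - t2 + t1 - t3 +
        ℓ (m + 1) (N + 1) (d + 1) * e0 - ℓ (m + 1) N d * e1 + hZ

end DepthRecursion

/-- Weighting the positions of the walk around a plane tree according to the depth, or according
to the number of descendants visited so far, leads to the same generating function. -/
theorem treeSum_depth_eq_desc {n : ℕ} {a γ β : ℂ}
    (hne : ∀ N d : ℕ, d < N → N ≤ n → a - γ * N - β * d ≠ 0) (k : ℕ) {N : ℕ} (hN0 : 0 < N)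
    (hN : N + k ≤ n) :
    treeSum (fun (N d _ : ℕ) => (a - γ * N - β * d)⁻¹) k N 0 0 =
      treeSum (fun (N _ D : ℕ) => (a - γ * N - β * D)⁻¹) k N 0 0 := by
  set w := fun (N d _ : ℕ) => (a - γ * N - β * d : ℂ)⁻¹ with hw
  set w' := fun (N _ D : ℕ) => (a - γ * N - β * D : ℂ)⁻¹ with hw'
  have hrec : DepthRecursion n a γ β fun k N d => treeSum w k N d 0 := by
    refine ⟨fun h1 h2 => hne _ _ h1 h2, fun {N d} h1 h2 => ?_, fun {k N d} h1 h2 => ?_⟩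
    · rw [treeSum.zero]
      exact mul_inv_cancel₀ (hne _ _ h1 h2)
    · rw [treeSum.succ', ← mul_assoc]
      rw [show w (N + k + 1) d (0 + k + 1) = (a - γ * (N + k + 1 : ℕ) - β * d : ℂ)⁻¹ from rfl,
        mul_inv_cancel₀ (hne (N + k + 1) d (by omega) h2), one_mul]
  induction k using Nat.strong_induction_on generalizing N with
  | _ k ih =>
    rcases k with _ | k
    · simp [treeSum.zero, hw, hw']
    · have h1 := hrec.succ_desc k hN0 (by omega)
      -- At `d = D = 0` the two final denominators agree; the bound `k + 1 < N + k + 1` needs `0 <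
      -- N`.
      refine mul_left_cancel₀ (hne (N + k + 1) (0 + k + 1) (by omega) (by omega)) ?_
      rw [h1, treeSum.succ' w', ← mul_assoc]
      rw [show w' (N + k + 1) 0 (0 + k + 1) =
        (a - γ * (N + k + 1 : ℕ) - β * (0 + k + 1 : ℕ) : ℂ)⁻¹ from rfl,
        mul_inv_cancel₀ (hne (N + k + 1) (0 + k + 1) (by omega) (by omega)), one_mul]
      refine Finset.sum_congr rfl fun p hp => ?_
      have := Finset.HasAntidiagonal.mem_antidiagonal.1 hp
      rw [ih p.1 (by omega) hN0 (by omega), ih p.2 (by omega) (by omega) (by omega),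
        treeSum.congr_depth (w := w') (fun _ _ _ _ => rfl) p.2 _ 0 (0 + 1)]

/-! ### Memorylessness and independence -/

lemma MeasureTheory.integrable_of_countable_of_bounded {α : Type*} [Countable α]
    [MeasurableSpace α] [MeasurableSingletonClass α] (μ : Measure α) [IsFiniteMeasure μ]
    {f : α → ℂ} {C : ℝ} (hf : ∀ a, ‖f a‖ ≤ C) : Integrable f μ :=
  Integrable.of_bound (StronglyMeasurable.of_discrete).aestronglyMeasurable C (.of_forall hf)

lemma MeasureTheory.MeasurePreserving.integral_comp_of_countable {α β : Type*}
    [MeasurableSpace α] [MeasurableSpace β] [Countable β] [MeasurableSingletonClass β]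
    {μ : Measure α} {ν : Measure β} {g : α → β} (hg : MeasurePreserving g μ ν) (f : β → ℂ) :
    ∫ a, f (g a) ∂μ = ∫ b, f b ∂ν := by
  rw [← hg.map_eq, integral_map hg.measurable.aemeasurable
    (StronglyMeasurable.of_discrete).aestronglyMeasurable]

section OutArcs

variable (V : Type*) [Fintype V] [Nonempty V]

lemma outArcsPMF_apply {p : unitInterval} (hp1 : p < 1) (l : List V) :
    outArcsPMF V p l =
      ENNReal.ofReal ((p : ℝ) ^ l.length * (1 - p)) * ((Fintype.card V : ENNReal) ^ l.length)⁻¹ := by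
  classical
  have hne : unitInterval.symm p ≠ 0 := by
    intro h
    have := congrArg unitInterval.symm h
    simp at this
    exact hp1.ne this
  unfold outArcsPMF
  rw [PMF.bind_apply, tsum_eq_single l.length]
  · rw [Measure.toPMF_apply, geometricMeasure_singleton hne]
    have h1 : (PMF.uniformOfFintype (Fin l.length → V)).map List.ofFn l =
        ((Fintype.card V : ENNReal) ^ l.length)⁻¹ := by
      rw [PMF.map_apply, tsum_eq_single l.get]
      · simp
      · intro g hg
        rw [if_neg]
        intro h
        exact hg (List.ofFn_injective (by rw [← h, List.ofFn_get]))
    rw [h1]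
    simp
  · intro k hk
    rw [PMF.map_apply]
    have : ∀ g : Fin k → V, l ≠ List.ofFn g := by
      rintro g rfl
      simp at hk
    simp [this]

/-- Memorylessness of the geometric law: behind a first arc, the rest is again distributed as a full
list. -/
lemma outArcsPMF_toMeasure_eq {p : unitInterval} (hp1 : p < 1) :
    (outArcsPMF V p).toMeasure = ENNReal.ofReal (1 - p) • Measure.dirac [] +
      ∑ u : V, ENNReal.ofReal (p / Fintype.card V) •
        (outArcsPMF V p).toMeasure.map (List.cons u) := by
  classical
  have hp : (0 : ℝ) ≤ p := p.2.1
  have hp' : (0 : ℝ) ≤ 1 - p := by linarith [p.2.2]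
  have hn : (0 : ℝ) < Fintype.card V := by exact_mod_cast Fintype.card_pos
  refine Measure.ext_of_singleton fun l => ?_
  rw [PMF.toMeasure_apply_singleton _ _ (MeasurableSet.of_discrete), outArcsPMF_apply V hp1]
  simp only [Measure.add_apply, Measure.smul_apply, Measure.finsetSum_apply, smul_eq_mul]
  cases l with
  | nil =>
    have : ∀ u : V, (outArcsPMF V p).toMeasure.map (List.cons u) {[]} = 0 := by
      intro u
      rw [Measure.map_apply Measurable.of_discrete MeasurableSet.of_discrete]
      convert! measure_empty (μ := (outArcsPMF V p).toMeasure)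
      ext; simp
    simp [this]
  | cons a l =>
    have h1 : ∀ u : V, (outArcsPMF V p).toMeasure.map (List.cons u) {a :: l} =
        if u = a then outArcsPMF V p l else 0 := by
      intro u
      rw [Measure.map_apply Measurable.of_discrete MeasurableSet.of_discrete]
      split_ifs with h
      · rw [← PMF.toMeasure_apply_singleton _ _ (MeasurableSet.of_discrete)]
        congr 1
        ext; simp [h]
      · convert! measure_empty (μ := (outArcsPMF V p).toMeasure)
        ext; simp [h]
    simp only [h1, mul_ite, mul_zero, Finset.sum_ite_eq', Finset.mem_univ, if_true]
    rw [outArcsPMF_apply V hp1, Measure.dirac_apply' _ MeasurableSet.of_discrete]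
    simp only [List.length_cons, Set.indicator, Set.mem_singleton_iff, reduceCtorEq, if_false,
      mul_zero, zero_add]
    rw [← ENNReal.ofReal_natCast, ← ENNReal.ofReal_pow hn.le, ← ENNReal.ofReal_pow hn.le,
      ← ENNReal.ofReal_inv_of_pos (by positivity), ← ENNReal.ofReal_inv_of_pos (by positivity),
      ← ENNReal.ofReal_mul (by positivity), ← ENNReal.ofReal_mul (by positivity),
      ← ENNReal.ofReal_mul (by positivity)]
    congr 1
    field_simp
    ring

lemma integral_outArcs {p : unitInterval} (hp1 : p < 1) {f : List V → ℂ} {C : ℝ}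
    (hf : ∀ l, ‖f l‖ ≤ C) :
    ∫ l, f l ∂(outArcsPMF V p).toMeasure = (1 - (p : ℝ)) * f [] +
      ((p : ℝ) / Fintype.card V : ℂ) * ∑ u : V, ∫ l, f (u :: l) ∂(outArcsPMF V p).toMeasure := by
  have hp : (0 : ℝ) ≤ p := p.2.1
  have hp' : (0 : ℝ) ≤ 1 - p := by linarith [p.2.2]
  have hint : ∀ (μ : Measure (List V)) [IsFiniteMeasure μ], Integrable f μ :=
    fun μ _ => integrable_of_countable_of_bounded μ hf
  have hmap : ∀ u : V, IsFiniteMeasure ((outArcsPMF V p).toMeasure.map (List.cons u)) :=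
    fun u => inferInstance
  conv_lhs => rw [outArcsPMF_toMeasure_eq V hp1]
  rw [integral_add_measure ((hint _).smul_measure ENNReal.ofReal_ne_top)
    (integrable_finsetSum_measure.2 fun u _ => (hint _).smul_measure ENNReal.ofReal_ne_top),
    integral_finsetSum_measure fun u _ => (hint _).smul_measure ENNReal.ofReal_ne_top,
    integral_smul_measure, integral_dirac, ENNReal.toReal_ofReal hp', Finset.mul_sum]
  congr 1
  · simp
  · refine Finset.sum_congr rfl fun u _ => ?_
    rw [integral_smul_measure, ENNReal.toReal_ofReal (by positivity),
      integral_map Measurable.of_discrete.aemeasurable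
        (StronglyMeasurable.of_discrete).aestronglyMeasurable]
    simp

variable [DecidableEq V]

instance (p : unitInterval) : IsProbabilityMeasure (geometricDigraph V p) := by
  unfold geometricDigraph; infer_instance

variable {V}

/-- Resampling the arcs that leave one vertex. -/
lemma measurePreserving_update_geometricDigraph (p : unitInterval) (u : V) :
    MeasurePreserving (fun q : List V × Multidigraph V => Function.update q.2 u q.1)
      ((outArcsPMF V p).toMeasure.prod (geometricDigraph V p)) (geometricDigraph V p) := by
  refine ⟨Measurable.of_discrete, ?_⟩
  conv_rhs => unfold geometricDigraph
  refine (Measure.pi_eq fun s _ => ?_).symm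
  rw [Measure.map_apply Measurable.of_discrete MeasurableSet.of_discrete]
  have : (fun q : List V × Multidigraph V => Function.update q.2 u q.1) ⁻¹' Set.univ.pi s =
      s u ×ˢ Set.univ.pi (Function.update s u Set.univ) := by
    ext q
    simp only [Set.mem_preimage, Set.mem_pi, Set.mem_univ, true_imp_iff, Set.mem_prod]
    constructor
    · intro h
      refine ⟨by simpa using h u, fun i => ?_⟩
      by_cases hi : i = u
      · subst hi; simp
      · simpa [hi] using h i
    · rintro ⟨h1, h2⟩ i
      by_cases hi : i = u
      · subst hi; simpa using h1
      · simpa [hi] using h2 i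
  rw [this, Measure.prod_prod, geometricDigraph, Measure.pi_pi,
    ← Finset.mul_prod_erase Finset.univ _ (Finset.mem_univ u),
    ← Finset.mul_prod_erase Finset.univ (fun i => (outArcsPMF V p).toMeasure (s i))
      (Finset.mem_univ u)]
  rw [Function.update_self, measure_univ, one_mul]
  congr 1
  refine Finset.prod_congr rfl fun i hi => ?_
  rw [Function.update_of_ne (Finset.ne_of_mem_erase hi)]

/-- The arcs leaving the vertices of `A` are independent of the other arcs. -/
lemma measurePreserving_piecewise_geometricDigraph (p : unitInterval) (A : Finset V) :
    MeasurePreserving (fun q : Multidigraph V × Multidigraph V => A.piecewise q.1 q.2)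
      ((geometricDigraph V p).prod (geometricDigraph V p)) (geometricDigraph V p) := by
  refine ⟨Measurable.of_discrete, ?_⟩
  conv_rhs => unfold geometricDigraph
  refine (Measure.pi_eq fun s _ => ?_).symm
  rw [Measure.map_apply Measurable.of_discrete MeasurableSet.of_discrete]
  have : (fun q : Multidigraph V × Multidigraph V => A.piecewise q.1 q.2) ⁻¹' Set.univ.pi s =
      Set.univ.pi (A.piecewise s fun _ => Set.univ) ×ˢ
        Set.univ.pi (A.piecewise (fun _ => Set.univ) s) := by
    ext q
    simp only [Set.mem_preimage, Set.mem_pi, Set.mem_univ, true_imp_iff, Set.mem_prod,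
      ← forall_and]
    refine forall_congr' fun i => ?_
    by_cases hi : i ∈ A <;> simp [hi]
  rw [this, Measure.prod_prod, geometricDigraph, Measure.pi_pi, Measure.pi_pi,
    ← Finset.prod_mul_distrib]
  refine Finset.prod_congr rfl fun i _ => ?_
  by_cases hi : i ∈ A <;> simp [hi]

lemma integral_geometricDigraph_update (p : unitInterval) (u : V) {f : Multidigraph V → ℂ} {C : ℝ}
    (hf : ∀ G, ‖f G‖ ≤ C) :
    ∫ G, f G ∂geometricDigraph V p = ∫ l, ∫ G, f (Function.update G u l) ∂geometricDigraph V p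
      ∂(outArcsPMF V p).toMeasure := by
  rw [← (measurePreserving_update_geometricDigraph p u).integral_comp_of_countable f]
  exact integral_prod _ (integrable_of_countable_of_bounded _ fun q => hf _)

/-- The arcs that have not been seen by the search are independent of its outcome. -/
lemma integral_exploreArcs (p : unitInterval) (v : V) (s : DFSState V) (l : List V)
    {f : DFSState V → Multidigraph V → ℂ} {C : ℝ} (hf : ∀ t G, ‖f t G‖ ≤ C)
    (hdep : ∀ t G G', (∀ u ∉ t.visited, G u = G' u) → f t G = f t G') :
    ∫ G, f (G.exploreArcs v s l).1 G ∂geometricDigraph V p =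
      ∫ G, ∫ G', f (G.exploreArcs v s l).1 G' ∂geometricDigraph V p ∂geometricDigraph V p := by
  set μ := geometricDigraph V p with hμ
  have hC : 0 ≤ C := (norm_nonneg _).trans (hf s fun _ => [])
  -- Decomposition by the final visited set `A`. On this event the search reads arcs only from
  -- vertices of `A` and `f` only the others, so two independent digraphs can be glued along `A`.
  have h1 : ∀ G : Multidigraph V, f (G.exploreArcs v s l).1 G = ∑ A : Finset V,
      if (G.exploreArcs v s l).1.visited = A then f (G.exploreArcs v s l).1 G else 0 := by
    intro G; simp
  have h2 : ∀ q : Multidigraph V × Multidigraph V,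
      f (q.1.exploreArcs v s l).1 q.2 = ∑ A : Finset V,
        if (q.1.exploreArcs v s l).1.visited = A then f (q.1.exploreArcs v s l).1 q.2 else 0 := by
    intro q; simp
  rw [← integral_prod (fun q : Multidigraph V × Multidigraph V => f (q.1.exploreArcs v s l).1 q.2)
    (integrable_of_countable_of_bounded _ fun q => hf _ _)]
  rw [integral_congr_ae (.of_forall h1), integral_congr_ae (.of_forall h2)]
  rw [integral_finsetSum, integral_finsetSum]
  rotate_left
  · intro A _
    refine integrable_of_countable_of_bounded _ (C := C) fun q => ?_
    split_ifs
    exacts [hf _ _, by simpa using hC]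
  · intro A _
    refine integrable_of_countable_of_bounded _ (C := C) fun q => ?_
    split_ifs
    exacts [hf _ _, by simpa using hC]
  refine Finset.sum_congr rfl fun A _ => ?_
  rw [← (measurePreserving_piecewise_geometricDigraph p A).integral_comp_of_countable]
  refine integral_congr_ae (.of_forall fun q => ?_)
  dsimp only
  have hA : ∀ u ∈ A, A.piecewise q.1 q.2 u = q.1 u := fun u hu => by simp [hu]
  by_cases h : (q.1.exploreArcs v s l).1.visited = A
  · have e : (Multidigraph.exploreArcs (A.piecewise q.1 q.2) v s l).1 =
        (q.1.exploreArcs v s l).1 :=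
      Multidigraph.exploreArcs_congr _ _ v s l fun u hu _ => (hA u (h ▸ hu)).symm
    rw [e, if_pos h, if_pos h]
    exact hdep _ _ _ fun u hu => by rw [h] at hu; simp [hu]
  · rw [if_neg h, if_neg]
    intro h'
    refine h ?_
    rw [← Multidigraph.exploreArcs_congr (A.piecewise q.1 q.2) q.1 v s l fun u hu _ =>
      hA u (h' ▸ hu)] at h'
    exact h'

lemma integral_swap_of_bounded {α β : Type*} [Countable α] [Countable β]
    [MeasurableSpace α] [MeasurableSpace β] [MeasurableSingletonClass α]
    [MeasurableSingletonClass β] (μ : Measure α) (ν : Measure β) [IsFiniteMeasure μ]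
    [IsFiniteMeasure ν] {f : α → β → ℂ} {C : ℝ} (hf : ∀ a b, ‖f a b‖ ≤ C) :
    ∫ a, ∫ b, f a b ∂ν ∂μ = ∫ b, ∫ a, f a b ∂μ ∂ν :=
  integral_integral_swap (integrable_of_countable_of_bounded _ fun q => hf q.1 q.2)

end OutArcs

/-! ### The generating function of the search below a vertex -/

namespace ArcWeights

/-- The generating function of the arcs that are explored between two consecutive tree moves of the
search in a random multidigraph, where each arc has probability `q`. -/
noncomputable def stepWeight (x : ArcWeights) (q : ℝ) (N d D : ℕ) : ℂ :=
  (1 - q * (x.loop + D * x.forward + d * x.back + (N - 1 - D - d) * x.cross))⁻¹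

/-- The generating function of the arcs that are explored in the search from a vertex `v`
with `d` ancestors and `D` descendants, when `N` of `n` vertices have been visited, restricted to
the event that `k` more vertices are visited. -/
noncomputable def searchSum (x : ArcWeights) (n : ℕ) (q r : ℝ) (k N d D : ℕ) : ℂ :=
  r ^ (k + 1) * (q * x.tree) ^ k * (n - N).descFactorial k * treeSum (x.stepWeight q) k N d D

lemma searchSum_zero (x : ArcWeights) (n : ℕ) (q r : ℝ) (N d D : ℕ) :
    x.searchSum n q r 0 N d D = x.stepWeight q N d D * r := by
  simp [searchSum, treeSum.zero, mul_comm]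

lemma searchSum_eq_zero (x : ArcWeights) {n : ℕ} (q r : ℝ) {k N : ℕ} (d D : ℕ) (h : n - N < k) :
    x.searchSum n q r k N d D = 0 := by
  simp [searchSum, Nat.descFactorial_eq_zero_iff_lt.2 h]

/-- Split at the first child. The heads of the tree arcs are chosen in order: the child, then the
first subtree, then the rest; the descending factorial factors accordingly. -/
lemma searchSum_succ (x : ArcWeights) {n : ℕ} (q r : ℝ) (k : ℕ) {N : ℕ} (d D : ℕ) (hN : N ≤ n) :
    x.searchSum n q r (k + 1) N d D = x.stepWeight q N d D * (q * x.tree * (n - N) *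
      ∑ a ∈ Finset.HasAntidiagonal.antidiagonal k, x.searchSum n q r a.1 (N + 1) (d + 1) 0 *
        x.searchSum n q r a.2 (N + 1 + a.1) d (D + 1 + a.1)) := by
  unfold searchSum
  rw [treeSum.succ, mul_left_comm]
  congr 1
  rw [Finset.mul_sum, Finset.mul_sum]
  refine Finset.sum_congr rfl fun a ha => ?_
  rw [← Finset.HasAntidiagonal.mem_antidiagonal.1 ha]
  have h : (n - N).descFactorial (a.1 + a.2 + 1) =
      (n - N) * ((n - (N + 1)).descFactorial a.1 * (n - (N + 1 + a.1)).descFactorial a.2) := by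
    rcases hN.eq_or_lt with rfl | hN
    · simp
    · obtain ⟨m, hm⟩ : ∃ m, n - N = m + 1 := ⟨n - N - 1, by omega⟩
      rw [hm, Nat.succ_descFactorial_succ, show n - (N + 1) = m by omega,
        show n - (N + 1 + a.1) = m - a.1 by omega]
      rw [← Nat.descFactorial_mul_descFactorial (k := a.1) (m := a.1 + a.2) (by omega),
        Nat.add_sub_cancel_left]
      ring
  rw [h]
  push_cast [Nat.cast_sub hN]
  ring

/-- The expectation, with respect to the weights `searchSum`, of a function of the number of
vertices visited at the end. -/
noncomputable def searchExpect (x : ArcWeights) (n : ℕ) (q r : ℝ) (N d D : ℕ) (φ : ℕ → ℂ) : ℂ :=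
  ∑ k ∈ Finset.range n, x.searchSum n q r k N d D * φ (N + k)

/-- Either the list of `v` ends, or a tree arc starts a search that returns with `M` visited
vertices, when `v` has `D + (M - N)` descendants. Since `0 < N`, the range `k < n` contains all
nonzero terms. -/
lemma searchExpect_eq (x : ArcWeights) {n : ℕ} (q r : ℝ) {N : ℕ} (d D : ℕ) (hN0 : 0 < N)
    (hN : N ≤ n) (φ : ℕ → ℂ) :
    x.searchExpect n q r N d D φ = x.stepWeight q N d D * (r * φ N + q * x.tree * (n - N) *
      x.searchExpect n q r (N + 1) (d + 1) 0
        fun M => x.searchExpect n q r M d (D + (M - N)) φ) := by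
  obtain ⟨m, rfl⟩ : ∃ m, n = m + 1 := ⟨n - 1, by omega⟩
  set n := m + 1 with hn
  have h1 : ∑ k ∈ Finset.range m, x.searchSum n q r (k + 1) N d D * φ (N + (k + 1)) =
      x.stepWeight q N d D * (q * x.tree * (n - N) * ∑ k ∈ Finset.range m,
        ∑ a ∈ Finset.HasAntidiagonal.antidiagonal k, x.searchSum n q r a.1 (N + 1) (d + 1) 0 *
          x.searchSum n q r a.2 (N + 1 + a.1) d (D + 1 + a.1) * φ (N + 1 + a.1 + a.2)) := by
    simp only [Finset.mul_sum]
    refine Finset.sum_congr rfl fun k _ => ?_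
    rw [x.searchSum_succ q r k d D hN, mul_assoc, mul_assoc, Finset.sum_mul, Finset.mul_sum,
      Finset.mul_sum]
    refine Finset.sum_congr rfl fun a ha => ?_
    rw [← Finset.HasAntidiagonal.mem_antidiagonal.1 ha,
      show N + 1 + a.1 + a.2 = N + (a.1 + a.2 + 1) by ring]
  have h2 : N < n → ∑ k ∈ Finset.range m,
        ∑ a ∈ Finset.HasAntidiagonal.antidiagonal k, x.searchSum n q r a.1 (N + 1) (d + 1) 0 *
          x.searchSum n q r a.2 (N + 1 + a.1) d (D + 1 + a.1) * φ (N + 1 + a.1 + a.2) =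
      x.searchExpect n q r (N + 1) (d + 1) 0
        fun M => x.searchExpect n q r M d (D + (M - N)) φ := by
    intro hlt
    simp only [Finset.Nat.sum_antidiagonal_eq_sum_range_succ_mk]
    rw [Finset.sum_range_diag_flip m fun i j => x.searchSum n q r i (N + 1) (d + 1) 0 *
          x.searchSum n q r j (N + 1 + i) d (D + 1 + i) * φ (N + 1 + i + j)]
    unfold searchExpect
    rw [Finset.sum_range_succ, x.searchSum_eq_zero (k := m) (N := N + 1) q r _ _ (by omega), zero_mul, add_zero]
    refine Finset.sum_congr rfl fun i hi => ?_
    have hi' := Finset.mem_range.1 hi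
    rw [Finset.mul_sum]
    rw [show D + (N + 1 + i - N) = D + 1 + i by omega]
    simp only [← mul_assoc]
    -- The surplus terms vanish: too few unvisited vertices remain for the first subtree or for the
    -- rest.
    refine Finset.sum_subset (Finset.range_mono (by omega)) fun j _ hj' => ?_
    have := mt Finset.mem_range.2 hj'
    by_cases h0 : n - (N + 1) < i
    · rw [x.searchSum_eq_zero q r _ _ h0]; simp
    · rw [x.searchSum_eq_zero q r d (D + 1 + i) (by omega)]; simp
  have h3 : x.searchExpect n q r N d D φ = x.stepWeight q N d D * r * φ N +
      ∑ k ∈ Finset.range m, x.searchSum n q r (k + 1) N d D * φ (N + (k + 1)) := by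
    rw [searchExpect, Finset.sum_range_succ', searchSum_zero, add_zero, add_comm]
  rw [h3, h1]
  rcases hN.eq_or_lt with h | h
  · rw [h]; ring
  · rw [h2 h]; ring

end ArcWeights

/-! ### The expected weight of a search from one vertex -/

lemma exists_norm_weight_mul_le {V : Type*} [Fintype V] {x : ArcWeights} (hx : x.NormLeOne) (φ : ℕ → ℂ) :
    ∃ C : ℝ, ∀ t : DFSState V, ‖x.weight t * φ t.visited.card‖ ≤ C := by
  refine ⟨∑ k ∈ Finset.range (Fintype.card V + 1), ‖φ k‖, fun t => ?_⟩
  rw [norm_mul]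
  refine (mul_le_of_le_one_left (norm_nonneg _) (hx.norm_weight_le t)).trans ?_
  exact Finset.single_le_sum (f := fun k => ‖φ k‖) (fun _ _ => norm_nonneg _)
    (Finset.mem_range.2 (Nat.lt_succ_of_le (Finset.card_le_univ _)))

lemma norm_div_card_mul_le {V : Type*} [Fintype V] [Nonempty V] (p : unitInterval) {N : ℕ} (hN : N ≤ Fintype.card V) {z : ℂ}
    (hz : ‖z‖ ≤ N) : ‖((p : ℝ) / Fintype.card V : ℂ) * z‖ ≤ p := by
  have hp : (0 : ℝ) ≤ p := p.2.1
  have hn : (0 : ℝ) < Fintype.card V := by exact_mod_cast Fintype.card_pos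
  have hN' : (N : ℝ) ≤ Fintype.card V := by exact_mod_cast hN
  rw [norm_mul, norm_div, Complex.norm_natCast, Complex.norm_real, Real.norm_of_nonneg hp,
    div_mul_eq_mul_div, div_le_iff₀ hn]
  exact mul_le_mul_of_nonneg_left (hz.trans hN') hp

section Search

variable {V : Type*} [Fintype V] [DecidableEq V] [Nonempty V]

/-- The expected weight after the search from `v`, including all arcs leaving `v`. -/
noncomputable def expectedWeight (p : unitInterval) (x : ArcWeights) (φ : ℕ → ℂ) (v : V)
    (s : DFSState V) : ℂ :=
  ∫ l, ∫ G, x.weight (G.exploreArcs v s l).1 * φ (G.exploreArcs v s l).1.visited.card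
    ∂geometricDigraph V p ∂(outArcsPMF V p).toMeasure

variable {p : unitInterval} {x : ArcWeights}

lemma norm_expectedWeight_le {φ : ℕ → ℂ} {C : ℝ}
    (hC : ∀ t : DFSState V, ‖x.weight t * φ t.visited.card‖ ≤ C) (v : V) (s : DFSState V) :
    ‖expectedWeight p x φ v s‖ ≤ C := by
  have h : ∀ l : List V, ‖∫ G, x.weight (G.exploreArcs v s l).1 *
      φ (G.exploreArcs v s l).1.visited.card ∂geometricDigraph V p‖ ≤ C := fun l => by
    simpa using norm_integral_le_of_norm_le_const (μ := geometricDigraph V p)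
      (.of_forall fun G => hC (Multidigraph.exploreArcs G v s l).1)
  simpa [expectedWeight] using
    norm_integral_le_of_norm_le_const (μ := (outArcsPMF V p).toMeasure) (.of_forall h)

/-- Conditioning on the first arc. -/
lemma expectedWeight_eq (hp1 : p < 1) (hx : x.NormLeOne) (φ : ℕ → ℂ) (v : V) (s : DFSState V) :
    expectedWeight p x φ v s = (1 - (p : ℝ)) * (x.weight s * φ s.visited.card) +
      ((p : ℝ) / Fintype.card V : ℂ) * (∑ u ∈ s.visited, expectedWeight p x φ v (s.addNonTree v u) +
        ∑ u ∈ s.visitedᶜ, ∫ l, ∫ G, x.weight (G.exploreArcs v s (u :: l)).1 *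
          φ (G.exploreArcs v s (u :: l)).1.visited.card
            ∂geometricDigraph V p ∂(outArcsPMF V p).toMeasure) := by
  obtain ⟨C, hC⟩ := exists_norm_weight_mul_le (V := V) hx φ
  have h : ∀ l : List V, ‖∫ G, x.weight (G.exploreArcs v s l).1 *
      φ (G.exploreArcs v s l).1.visited.card ∂geometricDigraph V p‖ ≤ C := fun l => by
    simpa using norm_integral_le_of_norm_le_const (μ := geometricDigraph V p)
      (.of_forall fun G => hC (Multidigraph.exploreArcs G v s l).1)
  conv_lhs => rw [expectedWeight]
  rw [integral_outArcs V hp1 h, ← Finset.sum_add_sum_compl s.visited]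
  congr 1
  · simp [Multidigraph.exploreArcs_nil]
  · congr 2
    refine Finset.sum_congr rfl fun u hu => ?_
    simp only [expectedWeight, Multidigraph.exploreArcs_cons_of_mem _ _ _ hu]

/-- The search along a tree arc `v → u`: first from `u`, and then along the remaining arcs
from `v`. -/
lemma integral_exploreArcs_cons_of_notMem (hx : x.NormLeOne) (φ : ℕ → ℂ) (v : V) (s : DFSState V)
    {u : V} (hu : u ∉ s.visited) :
    ∫ l, ∫ G, x.weight (G.exploreArcs v s (u :: l)).1 *
        φ (G.exploreArcs v s (u :: l)).1.visited.card
          ∂geometricDigraph V p ∂(outArcsPMF V p).toMeasure =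
      ∫ l, ∫ G, expectedWeight p x φ v (G.exploreArcs u (s.addTree v u) l).1
          ∂geometricDigraph V p ∂(outArcsPMF V p).toMeasure := by
  obtain ⟨C, hC⟩ := exists_norm_weight_mul_le (V := V) hx φ
  set W : DFSState V → ℂ := fun t => x.weight t * φ t.visited.card with hW
  set μ := geometricDigraph V p with hμ
  set ν := (outArcsPMF V p).toMeasure with hν
  have hCi : ∀ (f : Multidigraph V → DFSState V), ‖∫ G, W (f G) ∂μ‖ ≤ C := fun f => by
    simpa using norm_integral_le_of_norm_le_const (μ := μ) (.of_forall fun G => hC (f G))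
  have h1 : ∀ l : List V, ∫ G, W (G.exploreArcs v s (u :: l)).1 ∂μ = ∫ l', ∫ G, ∫ G',
      W (G'.exploreArcs v (G.exploreArcs u (s.addTree v u) l').1 l).1 ∂μ ∂μ ∂ν := by
    intro l
    rw [integral_geometricDigraph_update p u fun G => hC _]
    refine integral_congr_ae (.of_forall fun l' => ?_)
    have h2 : ∀ G : Multidigraph V,
        (Multidigraph.exploreArcs (Function.update G u l') v s (u :: l)).1 =
          (G.exploreArcs v (G.exploreArcs u (s.addTree v u) l').1 l).1 := by
      intro G
      have hG : ∀ w, w ≠ u → G w = Function.update G u l' w := fun w hw => by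
        simp [hw]
      rw [Multidigraph.exploreArcs_cons_of_notMem _ _ _ hu, Function.update_self,
        Multidigraph.exploreArcs_congr_of_notMem G (Function.update G u l') u (s.addTree v u) l'
          fun w hw => hG w fun h => hw (h ▸ Finset.mem_insert_self _ _)]
      refine Multidigraph.exploreArcs_congr_of_notMem G (Function.update G u l') v _ l
          fun w hw => hG w fun h => hw ?_
      rw [h]
      exact (G.exploreArcs u (s.addTree v u) l').2 (Finset.mem_insert_self _ _)
    simp only [h2]
    exact integral_exploreArcs p u (s.addTree v u) l'
      (f := fun t G => W (G.exploreArcs v t l).1) (fun t G => hC _) fun t G G' h => by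
        rw [Multidigraph.exploreArcs_congr_of_notMem G' G v t l fun w hw => (h w hw).symm]
  change ∫ l, ∫ G, W (G.exploreArcs v s (u :: l)).1 ∂μ ∂ν = _
  simp only [h1]
  rw [integral_swap_of_bounded ν ν (C := C)]
  · refine integral_congr_ae (.of_forall fun l' => ?_)
    dsimp only
    rw [integral_swap_of_bounded ν μ (C := C) fun l G => hCi _]
    rfl
  · intro l l'
    simpa using norm_integral_le_of_norm_le_const (μ := μ) (.of_forall fun G : Multidigraph V =>
      hCi fun G' => (G'.exploreArcs v (G.exploreArcs u (s.addTree v u) l').1 l).1)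

/-- Induction on the number of unvisited vertices handles tree arcs. Non-tree arcs leave that number
unchanged; for them the defect between the two sides satisfies a linear relation with total
coefficient at most `p < 1`, and iterating it forces the defect to vanish. -/
theorem expectedWeight_eq_searchExpect (hp1 : p < 1) (hx : x.NormLeOne) (φ : ℕ → ℂ) {v : V}
    {s : DFSState V} (hs : s.Consistent) (hv : v ∈ s.visited) :
    expectedWeight p x φ v s = x.weight s * x.searchExpect (Fintype.card V)
      (p / Fintype.card V) (1 - p) s.visited.card (s.depth v) (s.numDesc v) φ := by
  have hp : (0 : ℝ) ≤ p := p.2.1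
  have hp1' : (p : ℝ) < 1 := hp1
  set n := Fintype.card V with hn
  induction hm : n - s.visited.card using Nat.strong_induction_on generalizing s v φ with
  | _ m ih =>
    set N := s.visited.card with hN
    set d := s.depth v with hd
    set D := s.numDesc v with hD
    have hNn : N ≤ n := Finset.card_le_univ _
    have hN0 : 0 < N := Finset.card_pos.2 ⟨v, hv⟩
    set R := x.searchExpect n (p / n) (1 - p) N d D φ with hR
    set K := x.searchExpect n (p / n) (1 - p) (N + 1) (d + 1) 0
        fun M => x.searchExpect n (p / n) (1 - p) M d (D + (M - N)) φ with hK
    have hRK : R = x.stepWeight (p / n) N d D * ((1 - p : ℝ) * φ N + (p / n : ℝ) * x.tree *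
        (n - N) * K) := x.searchExpect_eq _ _ d D hN0 hNn φ
    have htree : ∀ (v : V) (s : DFSState V), s.Consistent → v ∈ s.visited → s.visited.card = N →
        s.depth v = d → s.numDesc v = D → ∀ u ∉ s.visited,
        ∫ l, ∫ G, x.weight (G.exploreArcs v s (u :: l)).1 *
          φ (G.exploreArcs v s (u :: l)).1.visited.card
            ∂geometricDigraph V p ∂(outArcsPMF V p).toMeasure = x.tree * x.weight s * K := by
      intro v s hs hv hsN hsd hsD u hu
      rw [integral_exploreArcs_cons_of_notMem hx φ v s hu]
      have hc : (s.addTree v u).visited.card = N + 1 := by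
        rw [Finset.card_insert_of_notMem hu, hsN]
      have hcn : (s.addTree v u).visited.card ≤ n := Finset.card_le_univ _
      have h1 : ∀ (l : List V) (G : Multidigraph V),
          expectedWeight p x φ v (G.exploreArcs u (s.addTree v u) l).1 =
          x.weight (G.exploreArcs u (s.addTree v u) l).1 *
            (fun M => x.searchExpect n (p / n) (1 - p) M d (D + (M - N)) φ)
              (G.exploreArcs u (s.addTree v u) l).1.visited.card := by
        intro l G
        have hext := (G.extendsBelow_exploreArcs u (s.addTree v u) l (hs.addTree hv hu)
          (Finset.mem_insert_self _ _))
        have hext' := hext.of_addTree hs hv hu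
        have hle := Finset.card_le_card hext.subset
        have hD' := hext'.numDesc_add hs
        rw [ih _ (by omega) φ hext.consistent (hext'.subset hv) rfl, hext'.depth_eq hv, hsd,
          show (G.exploreArcs u (s.addTree v u) l).1.numDesc v =
            D + ((G.exploreArcs u (s.addTree v u) l).1.visited.card - N) by omega]
      simp only [h1]
      have h2 := ih _ (by omega) (fun M => x.searchExpect n (p / n) (1 - p) M d (D + (M - N)) φ)
        (hs.addTree hv hu) (Finset.mem_insert_self _ _) rfl
      rw [expectedWeight] at h2
      rw [h2, x.weight_addTree hs hv hu, hc, hs.depth_addTree hv hu, hs.numDesc_addTree hv hu, hsd]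
    -- Stated for all states with the same `N`, `d`, `D`, a class closed under adding non-tree arcs,
    -- on which `R` and `K` are constant.
    have hsum : ∀ (v : V) (s : DFSState V), s.Consistent → v ∈ s.visited → s.visited.card = N →
        s.depth v = d → s.numDesc v = D →
        expectedWeight p x φ v s - x.weight s * R = ((p : ℝ) / n : ℂ) * ∑ u ∈ s.visited,
          (expectedWeight p x φ v (s.addNonTree v u) - x.weight (s.addNonTree v u) * R) := by
      intro v s hs hv hsN hsd hsD
      rw [expectedWeight_eq hp1 hx, Finset.sum_sub_distrib, ← Finset.sum_mul,
        Finset.sum_congr rfl fun u _ => x.weight_addNonTree hs v u, ← Finset.sum_mul,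
        Finset.sum_congr (s₁ := s.visitedᶜ) rfl fun u hu =>
          htree v s hs hv hsN hsd hsD u (Finset.mem_compl.1 hu),
        Finset.sum_const, Finset.card_compl, hsN, nsmul_eq_mul, Nat.cast_sub hNn]
      have hden : (1 - ((p : ℝ) / n : ℂ) * ∑ u ∈ s.visited, x.nonTreeWeight s v u) ≠ 0 := by
        intro h
        have h' : ‖((p : ℝ) / n : ℂ) * ∑ u ∈ s.visited, x.nonTreeWeight s v u‖ ≤ p := by
          refine norm_div_card_mul_le (V := V) p hNn ((norm_sum_le _ _).trans ?_)
          rw [← hsN]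
          simpa using Finset.sum_le_card_nsmul s.visited _ 1 fun u _ =>
            hx.norm_nonTreeWeight_le s v u
        rw [← sub_eq_zero.1 h, norm_one] at h'
        linarith
      have hstep : x.stepWeight (p / n) N d D =
          (1 - ((p : ℝ) / n : ℂ) * ∑ u ∈ s.visited, x.nonTreeWeight s v u)⁻¹ := by
        rw [hs.sum_nonTreeWeight hv, hsN, hsd, hsD, ArcWeights.stepWeight]
        push_cast
        rfl
      rw [hstep] at hRK
      have hRK' : (1 - ((p : ℝ) / n : ℂ) * ∑ u ∈ s.visited, x.nonTreeWeight s v u) * R =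
          ((1 - p : ℝ) * φ N + (p / n : ℝ) * x.tree * (n - N) * K) := by
        rw [hRK, mul_inv_cancel_left₀ hden]
      push_cast at hRK'
      linear_combination (-x.weight s) * hRK'
    obtain ⟨C, hC⟩ := exists_norm_weight_mul_le (V := V) hx φ
    have hcontr : ∀ j : ℕ, ∀ (v : V) (s : DFSState V), s.Consistent → v ∈ s.visited →
        s.visited.card = N → s.depth v = d → s.numDesc v = D →
        ‖expectedWeight p x φ v s - x.weight s * R‖ ≤ (p : ℝ) ^ j * (C + ‖R‖) := by
      intro j
      induction j with
      | zero =>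
        intro v s _ _ _ _ _
        rw [pow_zero, one_mul]
        refine (norm_sub_le _ _).trans (add_le_add (norm_expectedWeight_le hC v s) ?_)
        rw [norm_mul]
        exact mul_le_of_le_one_left (norm_nonneg _) (hx.norm_weight_le s)
      | succ j ihj =>
        intro v s hs hv hsN hsd hsD
        rw [hsum v s hs hv hsN hsd hsD, norm_mul]
        have hn0 : (0 : ℝ) < n := by exact_mod_cast Fintype.card_pos
        have hB : 0 ≤ (p : ℝ) ^ j * (C + ‖R‖) := (norm_nonneg _).trans (ihj v s hs hv hsN hsd hsD)
        have h1 : ‖∑ u ∈ s.visited, (expectedWeight p x φ v (s.addNonTree v u) -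
            x.weight (s.addNonTree v u) * R)‖ ≤ n * ((p : ℝ) ^ j * (C + ‖R‖)) := by
          refine (norm_sum_le_of_le _ fun u hu => ihj v (s.addNonTree v u)
            (hs.addNonTree hv hu) hv hsN ?_ ?_).trans ?_
          · rw [s.depth_addNonTree, hsd]
          · rw [s.numDesc_addNonTree, hsD]
          · rw [Finset.sum_const, hsN, nsmul_eq_mul]
            exact mul_le_mul_of_nonneg_right (by exact_mod_cast hNn) hB
        have h2 : ‖((p : ℝ) / n : ℂ)‖ = p / n := by
          rw [norm_div, Complex.norm_natCast, Complex.norm_real, Real.norm_of_nonneg hp]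
        rw [h2]
        refine (mul_le_mul_of_nonneg_left h1 (by positivity)).trans (le_of_eq ?_)
        field_simp
        ring
    have hlim : Filter.Tendsto (fun j : ℕ => (p : ℝ) ^ j * (C + ‖R‖)) Filter.atTop (nhds 0) := by
      simpa using (tendsto_pow_atTop_nhds_zero_of_lt_one hp hp1').mul_const (C + ‖R‖)
    have := ge_of_tendsto' hlim fun j => hcontr j v s hs hv rfl rfl rfl
    exact sub_eq_zero.1 (norm_le_zero_iff.1 this)

end Search

/-! ### Composition over successive roots -/

section Search

variable {V : Type*} [Fintype V] [DecidableEq V] [Nonempty V] {p : unitInterval}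

/-- The search of everything reachable from a new root, followed by the rest of the search. -/
lemma integral_weight_dfsFrom (hp1 : p < 1) {x : ArcWeights} (hx : x.NormLeOne) (root : RootRule V)
    {s : DFSState V} (hs : s.Consistent) (hsu : s.visited ≠ Finset.univ) {h : ℕ → ℂ}
    (ih : ∀ t : DFSState V, t.Consistent → s.visited.card < t.visited.card →
      ∫ G, x.weight (Multidigraph.dfsFrom G root t) ∂geometricDigraph V p =
        x.weight t * h t.visited.card) :
    ∫ G, x.weight (Multidigraph.dfsFrom G root s) ∂geometricDigraph V p =
      x.weight s * x.searchExpect (Fintype.card V) (p / Fintype.card V) (1 - p)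
        (s.visited.card + 1) 0 0 h := by
  set v := (root s hsu).1 with hv
  have hvs : v ∉ s.visited := (root s hsu).2
  have h1 : ∀ l : List V, ∫ G, x.weight (Multidigraph.dfsFrom (Function.update G v l) root s)
      ∂geometricDigraph V p = ∫ G, ∫ G', x.weight (Multidigraph.dfsFrom G' root
        (G.exploreArcs v (s.addRoot v) l).1) ∂geometricDigraph V p ∂geometricDigraph V p := by
    intro l
    rw [← integral_exploreArcs p v (s.addRoot v) l
      (f := fun t G => x.weight (Multidigraph.dfsFrom G root t)) (fun t G => hx.norm_weight_le _)
      fun t G G' h => by rw [Multidigraph.dfsFrom_congr G' G root t fun u hu => (h u hu).symm]]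
    refine integral_congr_ae (.of_forall fun G => ?_)
    have hG : ∀ w, w ≠ v → G w = Function.update G v l w := fun w hw => by simp [hw]
    have e : (Multidigraph.visit (Function.update G v l) v s).1 =
        (G.exploreArcs v (s.addRoot v) l).1 := by
      rw [Multidigraph.visit, Function.update_self]
      exact Multidigraph.exploreArcs_congr_of_notMem _ _ _ _ _ fun w hw =>
        hG w fun h => hw (h ▸ Finset.mem_insert_self _ _)
    dsimp only
    rw [Multidigraph.dfsFrom, dif_neg hsu, e, Multidigraph.dfsFrom_congr G]
    refine fun w hw => hG w fun h => hw ?_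
    rw [h]
    exact (G.exploreArcs v (s.addRoot v) l).2 (Finset.mem_insert_self _ _)
  rw [integral_geometricDigraph_update p v fun G => hx.norm_weight_le _]
  simp only [h1]
  have hc : (s.addRoot v).visited.card = s.visited.card + 1 := Finset.card_insert_of_notMem hvs
  have h2 : ∀ (l : List V) (G : Multidigraph V), ∫ G', x.weight (Multidigraph.dfsFrom G' root
        (G.exploreArcs v (s.addRoot v) l).1) ∂geometricDigraph V p =
      x.weight (G.exploreArcs v (s.addRoot v) l).1 *
        h (G.exploreArcs v (s.addRoot v) l).1.visited.card := by
    intro l G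
    have hext := G.extendsBelow_exploreArcs v (s.addRoot v) l (hs.addRoot v)
      (Finset.mem_insert_self _ _)
    have := Finset.card_le_card hext.subset
    exact ih _ hext.consistent (by omega)
  simp only [h2]
  have h3 := expectedWeight_eq_searchExpect hp1 hx h (hs.addRoot v) (Finset.mem_insert_self _ _)
  rw [hc, hs.depth_addRoot hvs, show (s.addRoot v).numDesc v = 0 from hs.numDesc_of_notMem hvs,
    x.weight_addRoot] at h3
  exact h3

/-- The expected weight of the whole search depends on the weights of the arcs only through the
generating functions for the search from a new root. -/
theorem integral_weight_dfs_congr (hp1 : p < 1) {x y : ArcWeights} (hx : x.NormLeOne)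
    (hy : y.NormLeOne) (root : RootRule V)
    (hxy : ∀ k N : ℕ, x.searchSum (Fintype.card V) (p / Fintype.card V) (1 - p) k (N + 1) 0 0 =
      y.searchSum (Fintype.card V) (p / Fintype.card V) (1 - p) k (N + 1) 0 0) :
    ∫ G, x.weight (Multidigraph.dfs G root) ∂geometricDigraph V p =
      ∫ G, y.weight (Multidigraph.dfs G root) ∂geometricDigraph V p := by
  have key : ∀ m : ℕ, ∃ h : ℕ → ℂ, ∀ s : DFSState V, s.Consistent →
      Fintype.card V - s.visited.card ≤ m →
      ∫ G, x.weight (Multidigraph.dfsFrom G root s) ∂geometricDigraph V p =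
        x.weight s * h s.visited.card ∧
      ∫ G, y.weight (Multidigraph.dfsFrom G root s) ∂geometricDigraph V p =
        y.weight s * h s.visited.card := by
    intro m
    induction m with
    | zero =>
      refine ⟨fun _ => 1, fun s _ hm => ?_⟩
      have hu : s.visited = Finset.univ := by
        rw [← Finset.card_eq_iff_eq_univ]
        have := Finset.card_le_univ s.visited
        omega
      have e : ∀ G : Multidigraph V, G.dfsFrom root s = s := fun G => by
        rw [Multidigraph.dfsFrom, dif_pos hu]
      simp [e]
    | succ m ih =>
      obtain ⟨h, hh⟩ := ih
      -- One function serves both weights because `hxy` identifies their search sums. It depends on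
      -- `N` alone, so the choice of roots plays no role.
      refine ⟨fun N => if Fintype.card V - N ≤ m then h N else
        x.searchExpect (Fintype.card V) (p / Fintype.card V) (1 - p) (N + 1) 0 0 h,
        fun s hs hm => ?_⟩
      by_cases hsm : Fintype.card V - s.visited.card ≤ m
      · simp only [if_pos hsm]
        exact hh s hs hsm
      · simp only [if_neg hsm]
        have hsu : s.visited ≠ Finset.univ := by
          intro hu
          rw [hu, Finset.card_univ] at hsm
          omega
        refine ⟨integral_weight_dfsFrom hp1 hx root hs hsu fun t ht hlt =>
          (hh t ht (by omega)).1, ?_⟩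
        rw [integral_weight_dfsFrom hp1 hy root hs hsu fun t ht hlt => (hh t ht (by omega)).2]
        simp only [ArcWeights.searchExpect, hxy]
  obtain ⟨h, hh⟩ := key (Fintype.card V)
  obtain ⟨h1, h2⟩ := hh ⟨∅, []⟩ DFSState.consistent_init (Nat.sub_le _ _)
  rw [x.weight_init] at h1
  rw [y.weight_init] at h2
  exact h1.trans h2.symm

end Search

/-! ### Exchanging forward and back arcs; the joint law -/

/-- If back arcs have the same weight as cross arcs, then exchanging the weights of forward and back
arcs does not change the generating function of the search from a root. -/
lemma searchSum_swap {V : Type*} [Fintype V] [Nonempty V] {p : unitInterval} (hp1 : p < 1)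
    {l f c t : ℂ} (hl : ‖l‖ ≤ 1) (hf : ‖f‖ ≤ 1) (hc : ‖c‖ ≤ 1) (k N : ℕ) :
    (⟨l, f, c, c, t⟩ : ArcWeights).searchSum (Fintype.card V) (p / Fintype.card V) (1 - p)
        k (N + 1) 0 0 =
      (⟨l, c, f, c, t⟩ : ArcWeights).searchSum (Fintype.card V) (p / Fintype.card V) (1 - p)
        k (N + 1) 0 0 := by
  by_cases hk : Fintype.card V - (N + 1) < k
  · rw [ArcWeights.searchSum_eq_zero _ _ _ _ _ hk, ArcWeights.searchSum_eq_zero _ _ _ _ _ hk]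
  · unfold ArcWeights.searchSum
    -- For `k = 0` truncated subtraction does not give `N + 1 ≤ n`, but the only position has `d = D
    -- = 0`, where the two weights agree.
    rcases Nat.eq_zero_or_pos k with rfl | hk0
    · simp [treeSum.zero, ArcWeights.stepWeight]
    have hp1' : (p : ℝ) < 1 := hp1
    congr 1
    set q : ℂ := (p : ℝ) / Fintype.card V with hq
    -- Each denominator is `1` minus `q` times a sum of `N` weights from the unit disc, a product of
    -- modulus at most `p < 1`; `d < N` makes the number of cross heads nonnegative.
    have hne : ∀ N d : ℕ, d < N → N ≤ Fintype.card V →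
        (1 - q * (l - c)) - (q * c) * N - (q * (f - c)) * d ≠ 0 := by
      intro N d hd hN h
      have e : (1 - q * (l - c)) - (q * c) * N - (q * (f - c)) * d =
          1 - q * (l + d * f + (N - 1 - d : ℕ) * c) := by
        rw [Nat.cast_sub (by omega), Nat.cast_sub (by omega)]
        push_cast
        ring
      have hb : ‖q * (l + d * f + (N - 1 - d : ℕ) * c)‖ ≤ p := by
        refine norm_div_card_mul_le (V := V) p hN ?_
        refine (norm_add₃_le).trans ?_
        simp only [norm_mul, Complex.norm_natCast]
        have hN' : (N : ℝ) = 1 + d + (N - 1 - d : ℕ) := by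
          norm_cast
          omega
        rw [hN']
        gcongr
        · exact mul_le_of_le_one_right (by positivity) hf
        · exact mul_le_of_le_one_right (by positivity) hc
      rw [e] at h
      rw [← sub_eq_zero.1 h, norm_one] at hb
      linarith
    have hmain := treeSum_depth_eq_desc hne k (N := N + 1) (by omega) (by omega)
    have e1 : (⟨l, f, c, c, t⟩ : ArcWeights).stepWeight (p / Fintype.card V) =
        fun (N _ D : ℕ) => ((1 - q * (l - c)) - (q * c) * N - (q * (f - c)) * D)⁻¹ := by
      ext N d D
      rw [ArcWeights.stepWeight, hq]
      push_cast
      ring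
    have e2 : (⟨l, c, f, c, t⟩ : ArcWeights).stepWeight (p / Fintype.card V) =
        fun (N d _ : ℕ) => ((1 - q * (l - c)) - (q * c) * N - (q * (f - c)) * d)⁻¹ := by
      ext N d D
      rw [ArcWeights.stepWeight, hq]
      push_cast
      ring
    rw [e1, e2, hmain]

/-- A finite measure on `ℕ × ℕ × ℕ × ℕ` is determined by its generating function on the unit
torus. -/
lemma MeasureTheory.Measure.ext_of_integral_pow {μ ν : Measure (ℕ × ℕ × ℕ × ℕ)} [IsFiniteMeasure μ]
    [IsFiniteMeasure ν]
    (h : ∀ a b c d : ℂ, ‖a‖ = 1 → ‖b‖ = 1 → ‖c‖ = 1 → ‖d‖ = 1 →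
      ∫ k, a ^ k.1 * b ^ k.2.1 * c ^ k.2.2.1 * d ^ k.2.2.2 ∂μ =
        ∫ k, a ^ k.1 * b ^ k.2.1 * c ^ k.2.2.1 * d ^ k.2.2.2 ∂ν) : μ = ν := by
  -- Seen in `ℝ⁴`, the generating function on the torus is a characteristic function.
  let e : ℕ × ℕ × ℕ × ℕ → EuclideanSpace ℝ (Fin 4) := fun k =>
    !₂[(k.1 : ℝ), (k.2.1 : ℝ), (k.2.2.1 : ℝ), (k.2.2.2 : ℝ)]
  have he : Function.Injective e := by
    rintro ⟨a, b, c, d⟩ ⟨a', b', c', d'⟩ h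
    have h0 := congrFun (congrArg WithLp.ofLp h) 0
    have h1 := congrFun (congrArg WithLp.ofLp h) 1
    have h2 := congrFun (congrArg WithLp.ofLp h) 2
    have h3 := congrFun (congrArg WithLp.ofLp h) 3
    simp [e] at h0 h1 h2 h3
    simp [h0, h1, h2, h3]
  have hem : MeasurableEmbedding e := ⟨he, Measurable.of_discrete, fun {s} _ =>
    (s.to_countable.image e).measurableSet⟩
  have hchar : ∀ (ρ : Measure (ℕ × ℕ × ℕ × ℕ)) (t : EuclideanSpace ℝ (Fin 4)),
      charFun (ρ.map e) t = ∫ k, Complex.exp (t 0 * Complex.I) ^ k.1 *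
        Complex.exp (t 1 * Complex.I) ^ k.2.1 * Complex.exp (t 2 * Complex.I) ^ k.2.2.1 *
        Complex.exp (t 3 * Complex.I) ^ k.2.2.2 ∂ρ := by
    intro ρ t
    rw [charFun_apply, hem.integral_map]
    refine integral_congr_ae (.of_forall fun k => ?_)
    simp only [← Complex.exp_nat_mul, ← Complex.exp_add]
    congr 1
    simp [e, PiLp.inner_apply, Fin.sum_univ_four]
    ring
  have hmap : μ.map e = ν.map e := by
    refine Measure.ext_of_charFun (funext fun t => ?_)
    rw [hchar, hchar]
    exact h _ _ _ _ (Complex.norm_exp_ofReal_mul_I _) (Complex.norm_exp_ofReal_mul_I _)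
      (Complex.norm_exp_ofReal_mul_I _) (Complex.norm_exp_ofReal_mul_I _)
  rw [← hem.comap_map μ, hmap, hem.comap_map]

theorem mainTheorem2 {V : Type*} [Fintype V] [DecidableEq V] [Nonempty V]
    (p : unitInterval) (hp0 : 0 < p) (hp1 : p < 1) (root : RootRule V)
    {Ω : Type*} [MeasurableSpace Ω] (P : Measure Ω) [IsProbabilityMeasure P]
    (G : Ω → Multidigraph V) (hG : HasLaw G (geometricDigraph V p) P) :
    IdentDistrib (fun ω => ((G ω).dfs root).numForward) (fun ω => ((G ω).dfs root).numBack) P P ∧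
    IdentDistrib
      (fun ω =>
        let s := (G ω).dfs root
        (s.numLoops, s.numForward, s.numBack + s.numCross, s.numTree))
      (fun ω =>
        let s := (G ω).dfs root
        (s.numLoops, s.numBack, s.numForward + s.numCross, s.numTree)) P P := by
  suffices h : IdentDistrib
      (fun ω =>
        let s := (G ω).dfs root
        (s.numLoops, s.numForward, s.numBack + s.numCross, s.numTree))
      (fun ω =>
        let s := (G ω).dfs root
        (s.numLoops, s.numBack, s.numForward + s.numCross, s.numTree)) P P from
    ⟨h.comp (u := fun k : ℕ × ℕ × ℕ × ℕ => k.2.1) Measurable.of_discrete, h⟩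
  let f : Multidigraph V → ℕ × ℕ × ℕ × ℕ := fun G =>
    let s := G.dfs root
    (s.numLoops, s.numForward, s.numBack + s.numCross, s.numTree)
  let g : Multidigraph V → ℕ × ℕ × ℕ × ℕ := fun G =>
    let s := G.dfs root
    (s.numLoops, s.numBack, s.numForward + s.numCross, s.numTree)
  have hf : Measurable f := Measurable.of_discrete
  have hg : Measurable g := Measurable.of_discrete
  have hfg : (geometricDigraph V p).map f = (geometricDigraph V p).map g := by
    refine Measure.ext_of_integral_pow fun l b c t hl hb hc ht => ?_
    rw [integral_map hf.aemeasurable (StronglyMeasurable.of_discrete).aestronglyMeasurable,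
      integral_map hg.aemeasurable (StronglyMeasurable.of_discrete).aestronglyMeasurable]
    -- Giving back and cross arcs the same weight in `x` records `B + C`; in `y` forward and cross
    -- arcs share it, which records `F + C`.
    have h := integral_weight_dfs_congr (V := V) hp1 (x := ⟨l, b, c, c, t⟩) (y := ⟨l, c, b, c, t⟩)
      ⟨hl.le, hb.le, hc.le, hc.le, ht.le⟩ ⟨hl.le, hc.le, hb.le, hc.le, ht.le⟩ root
      (searchSum_swap hp1 hl.le hb.le hc.le)
    convert! h using 1
    · refine integral_congr_ae (.of_forall fun G => ?_)
      simp only [f, ArcWeights.weight]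
      ring
    · refine integral_congr_ae (.of_forall fun G => ?_)
      simp only [g, ArcWeights.weight]
      ring
  refine ⟨hf.comp_aemeasurable hG.aemeasurable, hg.comp_aemeasurable hG.aemeasurable, ?_⟩
  change P.map (f ∘ G) = P.map (g ∘ G)
  rw [← AEMeasurable.map_map_of_aemeasurable hf.aemeasurable hG.aemeasurable,
    ← AEMeasurable.map_map_of_aemeasurable hg.aemeasurable hG.aemeasurable, hG.map_eq, hfg]
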